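/- Let $p(\cdot):\mathbb R^n\to[1,\infty]$ be a measurable exponent, with $p_-=\operatorname{ess\,inf}p$ and $p_+=\operatorname{ess\,sup}p$, and put $$\varrho_{p(\cdot)}(f)=\int_{\{p<\infty\}}|f(x)|^{p(x)}\,dx+\|f\|_{L^\infty(\{p=\infty\})}.$$ For a constant $q\in[1,\infty]$ and a sequence $f=(f_\nu)_\nu$ of measurable functions on $\mathbb R^n$, let $$\varrho_q(f)=\sum_{\nu}\inf\Big\{\lambda>0:\ \varrho_{p(\cdot)}\big(f_\nu/\lambda^{1/q}\big)\le 1\Big\}\qquad(\lambda^{1/\infty}=1,\ \inf\emptyset=\infty).$$ Let $\ell^q(L^{p(\cdot)})$ be the space of those $f$ (modulo equality almost everywhere) with $\varrho_q(f/\mu)<\infty$ for some $\mu>0$, normed by $\|f\|=\inf\{\mu>0:\varrho_q(f/\mu)\le1\}$. A normed space $X$ is uniformly convex if for every $\varepsilon\in(0,2]$ there is $\delta>0$ such that $\|\tfrac{x+y}2\|\le1-\delta$ whenever $\|x\|=\|y\|=1$ and $\|x-y\|\ge\varepsilon$. Then: 1. If $q\in(1,\infty)$ is constant and $1<p_-\le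 p_+<\infty$, then $\ell^q(L^{p(\cdot)})$ is uniformly convex. 2. $\ell^\infty(L^{p(\cdot)})$ is not uniformly convex. 3. $\ell^1(L^{p(\cdot)})$ is not uniformly convex. -/

import Mathlib

open MeasureTheory Filter
open scoped ENNReal

/-- Variable exponents of the class `𝒫(ℝⁿ)`: measurable functions with values in `[1, ∞]`
(inequalities between exponents are understood almost everywhere). -/
structure VariableExponent (n : ℕ) where
  toFun : EuclideanSpace ℝ (Fin n) → ℝ≥0∞
  measurable_toFun : Measurable toFun
  one_le : ∀ᵐ x, 1 ≤ toFun x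

namespace VariableExponent

/-- `p₋ = ess inf p`. -/
noncomputable def lower {n : ℕ} (p : VariableExponent n) : ℝ≥0∞ := essInf p.toFun volume

/-- `p₊ = ess sup p`. -/
noncomputable def upper {n : ℕ} (p : VariableExponent n) : ℝ≥0∞ := essSup p.toFun volume

end VariableExponent

/-- The modular `∫_{p < ∞} |f(x)|^{p(x)} dx + ‖f‖_{L^∞({p = ∞})}` of `L^{p(·)}(ℝⁿ)`. -/
noncomputable def varModular {𝕜 : Type*} [RCLike 𝕜] {n : ℕ}
    (p : EuclideanSpace ℝ (Fin n) → ℝ≥0∞) (f : EuclideanSpace ℝ (Fin n) → 𝕜) : ℝ≥0∞ :=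
  (∫⁻ x in {x | p x ≠ ∞}, ‖f x‖ₑ ^ (p x).toReal) +
    eLpNormEssSup f (volume.restrict {x | p x = ∞})

/-- The modular of `ℓ^{q(·)}(L^{p(·)})`:
`∑_ν inf {t > 0 : ϱ_{p(·)}(f_ν / t^{1/q(·)}) ≤ 1}`, where `inf ∅ = ∞` and `t^{1/∞} = 1`
(the latter since `(∞⁻¹).toReal = 0`). -/
noncomputable def mixedModular {𝕜 : Type*} [RCLike 𝕜] {n : ℕ}
    (p q : EuclideanSpace ℝ (Fin n) → ℝ≥0∞) (f : ℕ → EuclideanSpace ℝ (Fin n) → 𝕜) : ℝ≥0∞ :=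
  ∑' ν, ⨅ (t : ℝ) (_ : 0 < t)
    (_ : varModular p (fun x => (t ^ ((q x)⁻¹).toReal)⁻¹ • f ν x) ≤ 1), ENNReal.ofReal t

/-- Membership in `ℓ^{q(·)}(L^{p(·)})`: some positive multiple has finite modular.
(This forces every `f_ν` to lie in `L^{p(·)}`.) -/
def MemMixed {𝕜 : Type*} [RCLike 𝕜] {n : ℕ}
    (p q : EuclideanSpace ℝ (Fin n) → ℝ≥0∞) (f : ℕ → EuclideanSpace ℝ (Fin n) → 𝕜) : Prop :=
  ∃ r : ℝ, 0 < r ∧ mixedModular p q (fun ν x => r⁻¹ • f ν x) < ∞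

/-- The Luxemburg functional `inf {r > 0 : ϱ(f / r) ≤ 1}` of `ℓ^{q(·)}(L^{p(·)})`. -/
noncomputable def mixedNorm {𝕜 : Type*} [RCLike 𝕜] {n : ℕ}
    (p q : EuclideanSpace ℝ (Fin n) → ℝ≥0∞) (f : ℕ → EuclideanSpace ℝ (Fin n) → 𝕜) : ℝ :=
  sInf {r : ℝ | 0 < r ∧ mixedModular p q (fun ν x => r⁻¹ • f ν x) ≤ 1}

/-! ### Facts needed to see that, for constant `q ∈ [1, ∞]`, the functional above is a norm -/

section NormFacts

variable {𝕜 : Type*} [RCLike 𝕜] {n : ℕ}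

theorem varModular_congr_norm {p : EuclideanSpace ℝ (Fin n) → ℝ≥0∞}
    {f g : EuclideanSpace ℝ (Fin n) → 𝕜} (h : ∀ᵐ x, ‖f x‖ = ‖g x‖) :
    varModular p f = varModular p g := by
  have h' : ∀ᵐ x, ‖f x‖ₑ = ‖g x‖ₑ := by
    filter_upwards [h] with x hx
    rw [← ofReal_norm, ← ofReal_norm, hx]
  unfold varModular
  congr 1
  · apply lintegral_congr_ae
    filter_upwards [ae_restrict_of_ae h'] with x hx
    rw [hx]
  · unfold eLpNormEssSup
    apply essSup_congr_ae
    exact ae_restrict_of_ae h'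

theorem mixedModular_congr_norm {p q : EuclideanSpace ℝ (Fin n) → ℝ≥0∞}
    {f g : ℕ → EuclideanSpace ℝ (Fin n) → 𝕜} (h : ∀ ν, ∀ᵐ x, ‖f ν x‖ = ‖g ν x‖) :
    mixedModular p q f = mixedModular p q g := by
  unfold mixedModular
  congr 1
  funext ν
  have key : ∀ t : ℝ, varModular p (fun x => (t ^ ((q x)⁻¹).toReal)⁻¹ • f ν x) =
      varModular p (fun x => (t ^ ((q x)⁻¹).toReal)⁻¹ • g ν x) := by
    intro t
    apply varModular_congr_norm
    filter_upwards [h ν] with x hx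
    rw [norm_smul, norm_smul, hx]
  simp only [key]

theorem varModular_zero (p : VariableExponent n) :
    varModular p.toFun (fun _ => (0 : 𝕜)) = 0 := by
  unfold varModular
  have h1 : (∫⁻ x in {x | p.toFun x ≠ ∞}, ‖(0 : 𝕜)‖ₑ ^ (p.toFun x).toReal) = 0 := by
    have hm : MeasurableSet {x | p.toFun x ≠ ∞} :=
      p.measurable_toFun (measurableSet_singleton ∞).compl
    rw [setLIntegral_congr_fun_ae (g := fun _ => 0) hm]
    · simp
    · filter_upwards [p.one_le] with x hx hx'
      have : 0 < (p.toFun x).toReal := ENNReal.toReal_pos (by positivity) hx'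
      simp [this]
  rw [h1]
  rw [zero_add, eLpNormEssSup_eq_zero_iff]
  exact EventuallyEq.rfl

theorem varModular_convex (p : VariableExponent n) {f g : EuclideanSpace ℝ (Fin n) → 𝕜}
    (hf : AEStronglyMeasurable f) {a b : ℝ}
    (ha : 0 ≤ a) (hb : 0 ≤ b) (hab : a + b ≤ 1) :
    varModular p.toFun (fun x => a • f x + b • g x) ≤
      ENNReal.ofReal a * varModular p.toFun f + ENNReal.ofReal b * varModular p.toFun g := by
  have hm : MeasurableSet {x | p.toFun x ≠ ∞} :=
    p.measurable_toFun (measurableSet_singleton ∞).compl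
  have h1 : (∫⁻ x in {x | p.toFun x ≠ ∞}, ‖a • f x + b • g x‖ₑ ^ (p.toFun x).toReal) ≤
      ENNReal.ofReal a * (∫⁻ x in {x | p.toFun x ≠ ∞}, ‖f x‖ₑ ^ (p.toFun x).toReal) +
      ENNReal.ofReal b * (∫⁻ x in {x | p.toFun x ≠ ∞}, ‖g x‖ₑ ^ (p.toFun x).toReal) := by
    rw [← lintegral_const_mul' _ _ ENNReal.ofReal_ne_top,
      ← lintegral_const_mul' _ _ ENNReal.ofReal_ne_top, ← lintegral_add_left']
    · apply setLIntegral_mono_ae' hm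
      filter_upwards [p.one_le] with x hx hx'
      have h1 : 1 ≤ (p.toFun x).toReal := by
        simpa using ENNReal.toReal_mono hx' hx
      have h0 : 0 < (p.toFun x).toReal := by linarith
      have hle : ‖a • f x + b • g x‖ₑ ≤
          ENNReal.ofReal a * ‖f x‖ₑ + ENNReal.ofReal b * ‖g x‖ₑ := by
        refine (enorm_add_le _ _).trans ?_
        rw [enorm_smul, enorm_smul, Real.enorm_of_nonneg ha, Real.enorm_of_nonneg hb]
      refine (ENNReal.rpow_le_rpow hle h0.le).trans ?_
      have hJ := ENNReal.rpow_arith_mean_le_arith_mean_rpow (Finset.univ : Finset (Fin 3))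
        ![ENNReal.ofReal a, ENNReal.ofReal b, ENNReal.ofReal (1 - a - b)]
        ![‖f x‖ₑ, ‖g x‖ₑ, 0]
        (by
          simp only [Fin.sum_univ_three, Matrix.cons_val_zero, Matrix.cons_val_one,
            Matrix.cons_val]
          rw [← ENNReal.ofReal_add ha hb, ← ENNReal.ofReal_add (by linarith) (by linarith)]
          simp) h1
      simpa [Fin.sum_univ_three, h0] using hJ
    · apply AEMeasurable.const_mul
      exact (hf.enorm.restrict).pow (p.measurable_toFun.ennreal_toReal.aemeasurable)
  have h2 : eLpNormEssSup (fun x => a • f x + b • g x) (volume.restrict {x | p.toFun x = ∞}) ≤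
      ENNReal.ofReal a * eLpNormEssSup f (volume.restrict {x | p.toFun x = ∞}) +
      ENNReal.ofReal b * eLpNormEssSup g (volume.restrict {x | p.toFun x = ∞}) := by
    refine (eLpNormEssSup_add_le (f := fun x => a • f x) (g := fun x => b • g x)).trans ?_
    have e1 := eLpNormEssSup_const_smul_le (c := a) (f := f)
      (μ := volume.restrict {x | p.toFun x = ∞})
    have e2 := eLpNormEssSup_const_smul_le (c := b) (f := g)
      (μ := volume.restrict {x | p.toFun x = ∞})
    rw [Real.enorm_of_nonneg ha] at e1
    rw [Real.enorm_of_nonneg hb] at e2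
    exact add_le_add e1 e2
  unfold varModular
  refine (add_le_add h1 h2).trans (le_of_eq ?_)
  ring

theorem ae_eq_zero_of_varModular (p : VariableExponent n) {f : EuclideanSpace ℝ (Fin n) → 𝕜}
    (hf : AEStronglyMeasurable f) (h : varModular p.toFun f = 0) : ∀ᵐ x, f x = 0 := by
  have hm : MeasurableSet {x | p.toFun x ≠ ∞} :=
    p.measurable_toFun (measurableSet_singleton ∞).compl
  have hm' : MeasurableSet {x | p.toFun x = ∞} :=
    p.measurable_toFun (measurableSet_singleton ∞)
  unfold varModular at h
  obtain ⟨h1, h2⟩ := add_eq_zero.1 h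
  rw [lintegral_eq_zero_iff' ((hf.enorm.restrict).pow
    (p.measurable_toFun.ennreal_toReal.aemeasurable)), EventuallyEq, ae_restrict_iff' hm] at h1
  rw [eLpNormEssSup_eq_zero_iff, EventuallyEq, ae_restrict_iff' hm'] at h2
  filter_upwards [h1, h2, p.one_le] with x hx1 hx2 hx3
  by_cases hx : p.toFun x = ∞
  · simpa using hx2 hx
  · have h0 : 0 < (p.toFun x).toReal := ENNReal.toReal_pos (by positivity) hx
    have := hx1 hx
    simp only [Pi.zero_apply, ENNReal.rpow_eq_zero_iff_of_pos h0] at this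
    simpa using this

theorem mixedModular_convex (p : VariableExponent n) (q : ℝ≥0∞) (hq : 1 ≤ q)
    {f g : ℕ → EuclideanSpace ℝ (Fin n) → 𝕜}
    (hf : ∀ ν, AEStronglyMeasurable (f ν)) {a b : ℝ}
    (ha : 0 < a) (hb : 0 < b) (hab : a + b = 1) :
    mixedModular p.toFun (fun _ => q) (fun ν x => a • f ν x + b • g ν x) ≤
      ENNReal.ofReal a * mixedModular p.toFun (fun _ => q) f +
        ENNReal.ofReal b * mixedModular p.toFun (fun _ => q) g := by
  unfold mixedModular
  rw [← ENNReal.tsum_mul_left, ← ENNReal.tsum_mul_left, ← ENNReal.tsum_add]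
  refine ENNReal.tsum_le_tsum fun ν => ?_
  set s : ℝ := (q⁻¹).toReal with hs
  have hs0 : 0 ≤ s := ENNReal.toReal_nonneg
  have hs1 : s ≤ 1 := by
    have : q⁻¹ ≤ 1 := ENNReal.inv_le_one.2 hq
    have h := ENNReal.toReal_mono ENNReal.one_ne_top this
    rwa [ENNReal.toReal_one] at h
  have ha' : ENNReal.ofReal a ≠ 0 := by simpa using ha
  have hb' : ENNReal.ofReal b ≠ 0 := by simpa using hb
  simp only [ENNReal.mul_iInf_of_ne ha' ENNReal.ofReal_ne_top,
    ENNReal.mul_iInf_of_ne hb' ENNReal.ofReal_ne_top, ENNReal.iInf_add, ENNReal.add_iInf,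
    le_iInf_iff]
  intro u hu hgu t ht hft
  have hT : 0 < a * t + b * u := by positivity
  have hTs : 0 < (a * t + b * u) ^ s := Real.rpow_pos_of_pos hT s
  have hts : 0 < t ^ s := Real.rpow_pos_of_pos ht s
  have hus : 0 < u ^ s := Real.rpow_pos_of_pos hu s
  have hconc : a * t ^ s + b * u ^ s ≤ (a * t + b * u) ^ s := by
    have := (Real.concaveOn_rpow hs0 hs1).2 (x := t) (y := u) ht.le hu.le ha.le hb.le hab
    simpa using this
  have hw : a * t ^ s / (a * t + b * u) ^ s + b * u ^ s / (a * t + b * u) ^ s ≤ 1 := by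
    rw [← add_div]
    exact (div_le_one hTs).2 hconc
  have hadm : varModular p.toFun
      (fun x => ((a * t + b * u) ^ s)⁻¹ • (a • f ν x + b • g ν x)) ≤ 1 := by
    have hc := varModular_convex p (f := fun x => (t ^ s)⁻¹ • f ν x)
      (g := fun x => (u ^ s)⁻¹ • g ν x) ((hf ν).const_smul _)
      (a := a * t ^ s / (a * t + b * u) ^ s) (b := b * u ^ s / (a * t + b * u) ^ s)
      (by positivity) (by positivity) hw
    have he : (fun x => ((a * t + b * u) ^ s)⁻¹ • (a • f ν x + b • g ν x)) =
        fun x => (a * t ^ s / (a * t + b * u) ^ s) • (t ^ s)⁻¹ • f ν x +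
          (b * u ^ s / (a * t + b * u) ^ s) • (u ^ s)⁻¹ • g ν x := by
      funext x
      rw [smul_add, smul_smul, smul_smul, smul_smul, smul_smul]
      congr 2 <;> field_simp
    rw [he]
    refine hc.trans ?_
    calc _ ≤ ENNReal.ofReal (a * t ^ s / (a * t + b * u) ^ s) * 1 +
          ENNReal.ofReal (b * u ^ s / (a * t + b * u) ^ s) * 1 := by gcongr
      _ ≤ 1 := by
        rw [mul_one, mul_one, ← ENNReal.ofReal_add (by positivity) (by positivity)]
        exact ENNReal.ofReal_le_one.2 hw
  refine (iInf_le_of_le (a * t + b * u) (iInf_le_of_le hT (iInf_le_of_le hadm le_rfl))).trans ?_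
  rw [ENNReal.ofReal_add (by positivity) (by positivity), ENNReal.ofReal_mul ha.le,
    ENNReal.ofReal_mul hb.le]

theorem mixedModular_zero (p : VariableExponent n) (q : EuclideanSpace ℝ (Fin n) → ℝ≥0∞) :
    mixedModular p.toFun q (fun _ _ => (0 : 𝕜)) = 0 := by
  unfold mixedModular
  rw [ENNReal.tsum_eq_zero]
  intro ν
  refine le_antisymm (ENNReal.le_of_forall_pos_le_add fun ε hε _ => ?_) zero_le
  refine iInf_le_of_le (ε : ℝ) (iInf_le_of_le (by exact_mod_cast hε) (iInf_le_of_le ?_ ?_))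
  · simp only [smul_zero]
    rw [varModular_zero]
    exact zero_le_one
  · simp

/-- An element of the space has a positive multiple of modular at most one. -/
theorem MemMixed.exists_le_one {p : VariableExponent n} {q : ℝ≥0∞} (hq : 1 ≤ q)
    {f : ℕ → EuclideanSpace ℝ (Fin n) → 𝕜} (hm : ∀ ν, AEStronglyMeasurable (f ν))
    (hf : MemMixed p.toFun (fun _ => q) f) :
    ∃ r : ℝ, 0 < r ∧ mixedModular p.toFun (fun _ => q) (fun ν x => r⁻¹ • f ν x) ≤ 1 := by
  obtain ⟨r, hr, hM⟩ := hf
  set M := mixedModular p.toFun (fun _ => q) (fun ν x => r⁻¹ • f ν x) with hMdef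
  have hM0 : 0 ≤ M.toReal := ENNReal.toReal_nonneg
  set c : ℝ := M.toReal + 2 with hc
  have hc2 : 2 ≤ c := by linarith
  have hc0 : 0 < c := by linarith
  refine ⟨c * r, by positivity, ?_⟩
  have h := mixedModular_convex p q hq (f := fun ν x => r⁻¹ • f ν x)
    (g := fun _ _ => (0 : 𝕜)) (fun ν => (hm ν).const_smul _) (a := c⁻¹) (b := 1 - c⁻¹)
    (by positivity) (by
      have : c⁻¹ < 1 := inv_lt_one_of_one_lt₀ (by linarith)
      linarith) (by ring)
  rw [mixedModular_zero, ← hMdef, mul_zero, add_zero] at h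
  have he : (fun ν x => (c * r)⁻¹ • f ν x) =
      fun ν x => c⁻¹ • r⁻¹ • f ν x + (1 - c⁻¹) • (0 : 𝕜) := by
    funext ν x
    rw [smul_zero, add_zero, smul_smul, mul_inv]
  rw [he]
  refine h.trans ?_
  rw [← ENNReal.ofReal_toReal hM.ne, ← ENNReal.ofReal_mul (by positivity)]
  apply ENNReal.ofReal_le_one.2
  rw [inv_mul_le_iff₀ hc0]
  linarith

theorem mixedModular_add_le_one {p : VariableExponent n} {q : ℝ≥0∞} (hq : 1 ≤ q)
    {f g : ℕ → EuclideanSpace ℝ (Fin n) → 𝕜} (hm : ∀ ν, AEStronglyMeasurable (f ν))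
    {r s : ℝ} (hr : 0 < r) (hs : 0 < s)
    (hf : mixedModular p.toFun (fun _ => q) (fun ν x => r⁻¹ • f ν x) ≤ 1)
    (hg : mixedModular p.toFun (fun _ => q) (fun ν x => s⁻¹ • g ν x) ≤ 1) :
    mixedModular p.toFun (fun _ => q) (fun ν x => (r + s)⁻¹ • (f ν x + g ν x)) ≤ 1 := by
  have hab : r / (r + s) + s / (r + s) = 1 := by field_simp
  have h := mixedModular_convex p q hq (f := fun ν x => r⁻¹ • f ν x)
    (g := fun ν x => s⁻¹ • g ν x) (fun ν => (hm ν).const_smul _) (a := r / (r + s))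
    (b := s / (r + s)) (by positivity) (by positivity) hab
  have he : (fun ν x => (r + s)⁻¹ • (f ν x + g ν x)) =
      fun ν x => (r / (r + s)) • r⁻¹ • f ν x + (s / (r + s)) • s⁻¹ • g ν x := by
    funext ν x
    rw [smul_add, smul_smul, smul_smul]
    congr 2 <;> field_simp
  rw [he]
  refine h.trans ?_
  calc _ ≤ ENNReal.ofReal (r / (r + s)) * 1 + ENNReal.ofReal (s / (r + s)) * 1 := by gcongr
    _ = 1 := by
      rw [mul_one, mul_one, ← ENNReal.ofReal_add (by positivity) (by positivity), hab,
        ENNReal.ofReal_one]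

theorem mixedModular_smul_smul {p q : EuclideanSpace ℝ (Fin n) → ℝ≥0∞}
    (f : ℕ → EuclideanSpace ℝ (Fin n) → 𝕜) {c : 𝕜} (r : ℝ) :
    mixedModular p q (fun ν x => r⁻¹ • c • f ν x) =
      mixedModular p q (fun ν x => (r / ‖c‖)⁻¹ • f ν x) := by
  apply mixedModular_congr_norm
  intro ν
  refine ae_of_all _ fun x => ?_
  simp only [norm_smul, norm_inv, norm_div, Real.norm_eq_abs, abs_norm]
  rw [inv_div, div_eq_mul_inv]
  ring

theorem mixedNorm_nonneg {p q : EuclideanSpace ℝ (Fin n) → ℝ≥0∞}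
    (f : ℕ → EuclideanSpace ℝ (Fin n) → 𝕜) : 0 ≤ mixedNorm p q f :=
  Real.sInf_nonneg fun _ hr => hr.1.le

theorem mixedNorm_congr_norm {p q : EuclideanSpace ℝ (Fin n) → ℝ≥0∞}
    {f g : ℕ → EuclideanSpace ℝ (Fin n) → 𝕜} (h : ∀ ν, ∀ᵐ x, ‖f ν x‖ = ‖g ν x‖) :
    mixedNorm p q f = mixedNorm p q g := by
  have key : ∀ r : ℝ, mixedModular p q (fun ν x => r⁻¹ • f ν x) =
      mixedModular p q (fun ν x => r⁻¹ • g ν x) := by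
    intro r
    apply mixedModular_congr_norm
    intro ν
    filter_upwards [h ν] with x hx
    rw [norm_smul, norm_smul, hx]
  unfold mixedNorm
  simp only [key]

theorem mixedNorm_zero (p : VariableExponent n) (q : EuclideanSpace ℝ (Fin n) → ℝ≥0∞) :
    mixedNorm p.toFun q (fun _ _ => (0 : 𝕜)) = 0 := by
  refine le_antisymm (le_of_forall_pos_le_add fun ε hε => ?_) (mixedNorm_nonneg _)
  rw [zero_add]
  refine csInf_le ⟨0, fun r hr => hr.1.le⟩ ⟨hε, ?_⟩
  simp only [smul_zero]
  rw [mixedModular_zero]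
  exact zero_le_one

theorem mixedNorm_smul (p : VariableExponent n) (q : EuclideanSpace ℝ (Fin n) → ℝ≥0∞)
    (c : 𝕜) (f : ℕ → EuclideanSpace ℝ (Fin n) → 𝕜) :
    mixedNorm p.toFun q (fun ν x => c • f ν x) = ‖c‖ * mixedNorm p.toFun q f := by
  rcases eq_or_ne c 0 with rfl | hc
  · simp only [zero_smul, norm_zero, zero_mul]
    exact mixedNorm_zero p q
  have hc' : 0 < ‖c‖ := norm_pos_iff.2 hc
  unfold mixedNorm
  rw [← smul_eq_mul, ← Real.sInf_smul_of_nonneg hc'.le]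
  congr 1
  ext r
  rw [Set.mem_smul_set_iff_inv_smul_mem₀ hc'.ne']
  have h1 := mixedModular_smul_smul (p := p.toFun) (q := q) f (c := c) r
  rw [div_eq_inv_mul] at h1
  have h2 : 0 < ‖c‖⁻¹ * r ↔ 0 < r := mul_pos_iff_of_pos_left (inv_pos.2 hc')
  exact and_congr h2.symm (by rw [h1]; rfl)

theorem mixedNorm_add_le {p : VariableExponent n} {q : ℝ≥0∞} (hq : 1 ≤ q)
    {f g : ℕ → EuclideanSpace ℝ (Fin n) → 𝕜} (hmf : ∀ ν, AEStronglyMeasurable (f ν))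
    (hmg : ∀ ν, AEStronglyMeasurable (g ν))
    (hf : MemMixed p.toFun (fun _ => q) f) (hg : MemMixed p.toFun (fun _ => q) g) :
    mixedNorm p.toFun (fun _ => q) (fun ν x => f ν x + g ν x) ≤
      mixedNorm p.toFun (fun _ => q) f + mixedNorm p.toFun (fun _ => q) g := by
  obtain ⟨r₀, hr₀⟩ := hf.exists_le_one hq hmf
  obtain ⟨s₀, hs₀⟩ := hg.exists_le_one hq hmg
  refine le_of_forall_pos_le_add fun ε hε => ?_
  obtain ⟨r, hr, hrε⟩ := Real.lt_sInf_add_pos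
    (s := {r : ℝ | 0 < r ∧ mixedModular p.toFun (fun _ => q) (fun ν x => r⁻¹ • f ν x) ≤ 1})
    ⟨r₀, hr₀⟩ (half_pos hε)
  obtain ⟨s, hs, hsε⟩ := Real.lt_sInf_add_pos
    (s := {r : ℝ | 0 < r ∧ mixedModular p.toFun (fun _ => q) (fun ν x => r⁻¹ • g ν x) ≤ 1})
    ⟨s₀, hs₀⟩ (half_pos hε)
  have hrs : mixedNorm p.toFun (fun _ => q) (fun ν x => f ν x + g ν x) ≤ r + s :=
    csInf_le ⟨0, fun r hr => hr.1.le⟩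
      ⟨add_pos hr.1 hs.1, mixedModular_add_le_one hq hmf hr.1 hs.1 hr.2 hs.2⟩
  unfold mixedNorm at hrs ⊢
  linarith

theorem ae_eq_zero_of_mixedNorm {p : VariableExponent n} {q : ℝ≥0∞} (hq : 1 ≤ q)
    {f : ℕ → EuclideanSpace ℝ (Fin n) → 𝕜} (hm : ∀ ν, AEStronglyMeasurable (f ν))
    (hf : MemMixed p.toFun (fun _ => q) f) (h : mixedNorm p.toFun (fun _ => q) f = 0) (ν : ℕ) :
    ∀ᵐ x, f ν x = 0 := by
  apply ae_eq_zero_of_varModular p (hm ν)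
  set s : ℝ := (q⁻¹).toReal with hs
  have hs0 : 0 ≤ s := ENNReal.toReal_nonneg
  have hs1 : s ≤ 1 := by
    have : q⁻¹ ≤ 1 := ENNReal.inv_le_one.2 hq
    have h := ENNReal.toReal_mono ENNReal.one_ne_top this
    rwa [ENNReal.toReal_one] at h
  refine le_antisymm (ENNReal.le_of_forall_pos_le_add fun ε hε _ => ?_) zero_le
  rw [zero_add]
  set δ : ℝ := min ε 1 with hδ
  have hδ0 : 0 < δ := lt_min (by exact_mod_cast hε) one_pos
  obtain ⟨r₀, hr₀⟩ := hf.exists_le_one hq hm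
  obtain ⟨r, hr, hrδ⟩ := Real.lt_sInf_add_pos
    (s := {r : ℝ | 0 < r ∧ mixedModular p.toFun (fun _ => q) (fun ν x => r⁻¹ • f ν x) ≤ 1})
    ⟨r₀, hr₀⟩ (half_pos hδ0)
  unfold mixedNorm at h
  rw [h, zero_add] at hrδ
  have hlt : (⨅ (t : ℝ) (_ : 0 < t)
      (_ : varModular p.toFun (fun x => (t ^ s)⁻¹ • r⁻¹ • f ν x) ≤ 1), ENNReal.ofReal t) < 2 :=
    lt_of_le_of_lt ((ENNReal.le_tsum (f := fun ν => ⨅ (t : ℝ) (_ : 0 < t)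
      (_ : varModular p.toFun (fun x => (t ^ s)⁻¹ • r⁻¹ • f ν x) ≤ 1), ENNReal.ofReal t) ν).trans
      hr.2) (by norm_num)
  simp only [iInf_lt_iff] at hlt
  obtain ⟨t, ht, hft, ht2⟩ := hlt
  have ht2' : t < 2 := by
    have := (ENNReal.ofReal_lt_iff_lt_toReal ht.le (by norm_num)).1 ht2
    simpa using this
  have hts : 0 < t ^ s := Real.rpow_pos_of_pos ht s
  have hts2 : t ^ s ≤ 2 := by
    calc t ^ s ≤ 2 ^ s := Real.rpow_le_rpow ht.le ht2'.le hs0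
      _ ≤ 2 ^ (1 : ℝ) := Real.rpow_le_rpow_of_exponent_le (by norm_num) hs1
      _ = 2 := by norm_num
  have hκ : r * t ^ s ≤ δ := by
    nlinarith [hr.1]
  have hc := varModular_convex p (f := fun x => (t ^ s)⁻¹ • r⁻¹ • f ν x)
    (g := fun _ => (0 : 𝕜)) (((hm ν).const_smul _).const_smul _) (a := r * t ^ s) (b := 0)
    (mul_nonneg hr.1.le hts.le) le_rfl
    (by rw [add_zero]; exact hκ.trans (min_le_right _ _))
  have he : (fun x => (r * t ^ s) • (t ^ s)⁻¹ • r⁻¹ • f ν x + (0 : ℝ) • (0 : 𝕜)) = f ν := by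
    funext x
    have hr0 := hr.1.ne'
    rw [smul_zero, add_zero, smul_smul, smul_smul]
    have : r * t ^ s * ((t ^ s)⁻¹ * r⁻¹) = 1 := by field_simp
    rw [← mul_assoc] at this
    rw [this, one_smul]
  rw [he] at hc
  refine hc.trans ?_
  calc _ ≤ ENNReal.ofReal (r * t ^ s) * 1 + ENNReal.ofReal 0 * _ := by gcongr
    _ = ENNReal.ofReal (r * t ^ s) := by simp
    _ ≤ ENNReal.ofReal ε := ENNReal.ofReal_le_ofReal (hκ.trans (min_le_left _ _))
    _ = ε := by simp

end NormFacts

/-! ### The space `ℓ^q(L^{p(·)})` for constant `q ∈ [1, ∞]` -/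

/-- The linear space `ℓ^q(L^{p(·)}(ℝⁿ))`: sequences of (classes, modulo equality almost
everywhere, of) measurable functions for which some positive multiple has finite modular. -/
noncomputable def mixedSubmodule (𝕜 : Type*) [RCLike 𝕜] {n : ℕ} (p : VariableExponent n)
    (q : ℝ≥0∞) [hq : Fact (1 ≤ q)] :
    Submodule 𝕜 (ℕ → (EuclideanSpace ℝ (Fin n) →ₘ[volume] 𝕜)) where
  carrier := {f | MemMixed p.toFun (fun _ => q) fun ν => ⇑(f ν)}
  zero_mem' := by
    refine ⟨1, one_pos, ?_⟩
    have h : mixedModular p.toFun (fun _ => q) (fun ν x => (1 : ℝ)⁻¹ •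
        ((0 : ℕ → (EuclideanSpace ℝ (Fin n) →ₘ[volume] 𝕜)) ν) x) =
        mixedModular p.toFun (fun _ => q) (fun _ _ => (0 : 𝕜)) := by
      apply mixedModular_congr_norm
      intro ν
      filter_upwards [AEEqFun.coeFn_zero (α := EuclideanSpace ℝ (Fin n)) (μ := volume) (β := 𝕜)]
        with x hx
      simp [hx]
    rw [h, mixedModular_zero]
    exact ENNReal.zero_lt_top
  add_mem' := by
    intro f g hf hg
    obtain ⟨r, hr, hfr⟩ := MemMixed.exists_le_one hq.out (fun ν => (f ν).aestronglyMeasurable) hf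
    obtain ⟨s, hs, hgs⟩ := MemMixed.exists_le_one hq.out (fun ν => (g ν).aestronglyMeasurable) hg
    refine ⟨r + s, add_pos hr hs, ?_⟩
    have h := mixedModular_add_le_one hq.out (fun ν => (f ν).aestronglyMeasurable) hr hs hfr hgs
    rw [mixedModular_congr_norm (g := fun ν x => (r + s)⁻¹ • (f ν x + g ν x))]
    · exact h.trans_lt ENNReal.one_lt_top
    · intro ν
      filter_upwards [AEEqFun.coeFn_add (f ν) (g ν)] with x hx
      simp [hx]
  smul_mem' := by
    rintro c f ⟨r, hr, hfr⟩
    have he : ∀ s : ℝ, mixedModular p.toFun (fun _ => q) (fun ν x => s⁻¹ • ((c • f) ν) x) =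
        mixedModular p.toFun (fun _ => q) (fun ν x => s⁻¹ • c • f ν x) := by
      intro s
      apply mixedModular_congr_norm
      intro ν
      filter_upwards [AEEqFun.coeFn_smul c (f ν)] with x hx
      simp [hx]
    rcases eq_or_ne c 0 with rfl | hc
    · refine ⟨1, one_pos, ?_⟩
      rw [he]
      simp only [zero_smul, smul_zero]
      rw [mixedModular_zero]
      exact ENNReal.zero_lt_top
    · have hc' : 0 < ‖c‖ := norm_pos_iff.2 hc
      refine ⟨r * ‖c‖, by positivity, ?_⟩
      rw [he, mixedModular_smul_smul, mul_div_cancel_right₀ _ hc'.ne']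
      exact hfr

/-- The space `ℓ^q(L^{p(·)}(ℝⁿ))` with its Luxemburg norm. -/
def MixedSpace (𝕜 : Type*) [RCLike 𝕜] {n : ℕ} (p : VariableExponent n)
    (q : ℝ≥0∞) [Fact (1 ≤ q)] : Type _ :=
  mixedSubmodule 𝕜 p q

section Instances

variable {𝕜 : Type*} [RCLike 𝕜] {n : ℕ} (p : VariableExponent n) (q : ℝ≥0∞) [hq : Fact (1 ≤ q)]

noncomputable instance : AddCommGroup (MixedSpace 𝕜 p q) :=
  inferInstanceAs (AddCommGroup (mixedSubmodule 𝕜 p q))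

noncomputable instance : Module 𝕜 (MixedSpace 𝕜 p q) :=
  inferInstanceAs (Module 𝕜 (mixedSubmodule 𝕜 p q))

noncomputable instance : Norm (MixedSpace 𝕜 p q) where
  norm f := mixedNorm p.toFun (fun _ => q) fun ν => ⇑(f.1 ν)

theorem MixedSpace.normCore : NormedSpace.Core 𝕜 (MixedSpace 𝕜 p q) where
  norm_nonneg f := mixedNorm_nonneg _
  norm_smul c f := by
    refine Eq.trans ?_ (mixedNorm_smul p (fun _ => q) c fun ν => ⇑(f.1 ν))
    apply mixedNorm_congr_norm
    intro ν
    filter_upwards [AEEqFun.coeFn_smul c (f.1 ν)] with x hx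
    exact congrArg norm hx
  norm_triangle f g := by
    refine le_trans (le_of_eq ?_) (mixedNorm_add_le hq.out
      (fun ν => (f.1 ν).aestronglyMeasurable) (fun ν => (g.1 ν).aestronglyMeasurable) f.2 g.2)
    apply mixedNorm_congr_norm
    intro ν
    filter_upwards [AEEqFun.coeFn_add (f.1 ν) (g.1 ν)] with x hx
    exact congrArg norm hx
  norm_eq_zero_iff f := by
    constructor
    · intro h
      apply Subtype.ext
      funext ν
      apply AEEqFun.ext
      filter_upwards [ae_eq_zero_of_mixedNorm hq.out
        (fun ν => (f.1 ν).aestronglyMeasurable) f.2 h ν,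
        AEEqFun.coeFn_zero (α := EuclideanSpace ℝ (Fin n)) (μ := volume) (β := 𝕜)] with x hx hx0
      rw [hx]
      exact hx0.symm
    · rintro rfl
      refine Eq.trans ?_ (mixedNorm_zero (𝕜 := 𝕜) p fun _ => q)
      apply mixedNorm_congr_norm
      intro ν
      filter_upwards [AEEqFun.coeFn_zero (α := EuclideanSpace ℝ (Fin n)) (μ := volume) (β := 𝕜)]
        with x hx
      exact congrArg norm hx

noncomputable instance : NormedAddCommGroup (MixedSpace 𝕜 p q) :=
  NormedAddCommGroup.ofCore (MixedSpace.normCore p q)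

noncomputable instance : NormedSpace 𝕜 (MixedSpace 𝕜 p q) :=
  NormedSpace.ofCore (MixedSpace.normCore p q)

end Instances

/-! The positive part transfers uniform convexity from the scalars to `L^{p(·)}`, and from there to
the sequence space, by one inequality used twice. Suppose `a, b, s, d` behave like `‖x‖, ‖y‖, ‖x +
y‖, ‖x - y‖` in a uniformly convex space. For every slack `ε` there is a constant `C` with `d^p ≤ ε
(a^p + b^p) + C ((a^p + b^p)/2 - (s/2)^p)`, uniformly for `p` in a compact subinterval of `(1, ∞)`
(`exists_rpow_convexity_gap`). The inequality is linear in the `p`-th powers, so it can be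
integrated or summed.

Integrated over `x` with the varying exponent `p(x)`, it makes the modular of `L^{p(·)}` uniformly
convex (`exists_varModular_convexity_gap`). Because `p₊ < ∞`, smallness of the modular and of the
Luxemburg norm control each other, so the norm is uniformly convex as well
(`exists_luxemburg_add_le`). For constant finite `q` the modular of the mixed space is the sum of
the `q`-th powers of the Luxemburg norms (`mixedModular_eq_tsum`). Hence the same inequality, now
with exponent `q` and summed over the index, gives the first claim.

For the endpoints, put one nonzero function at index 0 or at index 1 to get `u` and `v`. For `q = ∞`
all of `u`, `v`, `u ± v` have equal norm; for `q = 1` the norm of `u ± v` is twice that of `u`.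
Either way the unit sphere contains two points at distance 2 whose midpoint has norm 1, whatever the
exponent `p`. -/

/-! ### Scalar convexity inequalities -/

/-- Quantitative midpoint convexity of `t ↦ t ^ p` for a pair `(1, t)` whose midpoint is known to
stay below `1 - δ / 2`, uniformly for `p` in a compact subinterval of `(1, ∞)`. -/
theorem exists_pos_le_midpoint_gap {p₁ p₂ δ : ℝ} (hp₁ : 1 < p₁) (hδ : 0 < δ) (hδ1 : δ ≤ 1) :
    ∃ c : ℝ, 0 < c ∧ ∀ p ∈ Set.Icc p₁ p₂, ∀ t ∈ Set.Icc (0 : ℝ) 1,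
      c ≤ (1 + t ^ p) / 2 - (min ((1 + t) / 2) (1 - δ / 2)) ^ p := by
  set g : ℝ × ℝ → ℝ := fun z =>
    (1 + z.1 ^ z.2) / 2 - (min ((1 + z.1) / 2) (1 - δ / 2)) ^ z.2 with hg
  set K : Set (ℝ × ℝ) := Set.Icc 0 1 ×ˢ Set.Icc p₁ p₂ with hK
  have hpos : ∀ z ∈ K, 0 < g z := by
    rintro ⟨t, p⟩ ⟨⟨ht0, ht1⟩, ⟨hp, -⟩⟩
    simp only at ht0 ht1 hp
    have hp1 : 1 < p := by linarith
    have hm0 : 0 ≤ min ((1 + t) / 2) (1 - δ / 2) := le_min (by linarith) (by linarith)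
    simp only [hg]
    -- For `t < 1` strict convexity of the power gives a positive gap; at `t = 1` it degenerates,
    -- and the cap `1 - δ / 2` supplies the gap instead.
    rcases ht1.lt_or_eq with ht1 | rfl
    · have h := (strictConvexOn_rpow hp1).2 (Set.mem_Ici.2 (zero_le_one' ℝ)) (Set.mem_Ici.2 ht0)
        ht1.ne' (one_half_pos (α := ℝ)) one_half_pos (add_halves 1)
      simp only [smul_eq_mul, Real.one_rpow] at h
      have h2 : (min ((1 + t) / 2) (1 - δ / 2)) ^ p ≤ (1 / 2 * 1 + 1 / 2 * t) ^ p :=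
        Real.rpow_le_rpow hm0 ((min_le_left _ _).trans (by linarith)) (by linarith)
      linarith
    · have h2 : (min ((1 + 1) / 2) (1 - δ / 2)) ^ p < 1 :=
        Real.rpow_lt_one hm0 ((min_le_right _ _).trans_lt (by linarith)) (by linarith)
      rw [Real.one_rpow]
      linarith
  have hcont : ContinuousOn g K := by
    -- The base may vanish, so joint continuity of the real power relies on the exponent being
    -- positive.
    have hz : ∀ z ∈ K, 0 < z.2 := fun z hz => by linarith [hz.2.1]
    refine ContinuousOn.sub (ContinuousOn.div_const (continuousOn_const.add ?_) _) ?_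
    · exact continuous_fst.continuousOn.rpow continuous_snd.continuousOn
        fun z h => Or.inr (hz z h)
    · refine ContinuousOn.rpow (Continuous.continuousOn (by fun_prop))
        continuous_snd.continuousOn fun z h => Or.inr (hz z h)
  rcases K.eq_empty_or_nonempty with hE | hne
  · refine ⟨1, one_pos, fun p hp t ht => ?_⟩
    have : (t, p) ∈ K := ⟨ht, hp⟩
    simp [hE] at this
  · obtain ⟨z, hz, hmin⟩ := (isCompact_Icc.prod isCompact_Icc).exists_isMinOn hne hcont
    exact ⟨g z, hpos z hz, fun p hp t ht => hmin (show (t, p) ∈ K from ⟨ht, hp⟩)⟩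

theorem rpow_midpoint_le {a b p : ℝ} (ha : 0 ≤ a) (hb : 0 ≤ b) (hp : 1 ≤ p) :
    ((a + b) / 2) ^ p ≤ (a ^ p + b ^ p) / 2 := by
  have h := (convexOn_rpow hp).2 (Set.mem_Ici.2 ha) (Set.mem_Ici.2 hb)
    (one_half_pos (α := ℝ)).le one_half_pos.le (add_halves 1)
  simp only [smul_eq_mul] at h
  rw [show (a + b) / 2 = 1 / 2 * a + 1 / 2 * b by ring]
  linarith

/-- If `a, b, s, d` play the role of `‖x‖, ‖y‖, ‖x + y‖, ‖x - y‖` in a uniformly convex space,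
then `d ^ p` is controlled by a small multiple of `a ^ p + b ^ p` and a large multiple of the
convexity gap `(a ^ p + b ^ p) / 2 - (s / 2) ^ p`. -/
theorem exists_rpow_convexity_gap {p₁ p₂ ε δ : ℝ} (hp₁ : 1 < p₁) (hε : 0 < ε) (hε1 : ε ≤ 1)
    (hδ : 0 < δ) (hδ1 : δ ≤ 1) :
    ∃ C : ℝ, 0 < C ∧ ∀ p ∈ Set.Icc p₁ p₂, ∀ a b s d : ℝ, 0 ≤ a → 0 ≤ b → 0 ≤ s → 0 ≤ d →
      s ≤ a + b → d ≤ a + b → (ε * max a b ≤ d → s ≤ (2 - δ) * max a b) →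
      d ^ p + C * (s / 2) ^ p ≤ (ε + C / 2) * (a ^ p + b ^ p) := by
  obtain ⟨c, hc, hgap⟩ := exists_pos_le_midpoint_gap (p₂ := p₂) hp₁ hδ hδ1
  -- Chosen so that `C` times the lower bound `c a^p` of the gap equals `2^p₂ a^p`, which dominates
  -- `d^p` because `d ≤ 2 a`.
  refine ⟨2 ^ p₂ / c, by positivity, fun p hp => ?_⟩
  set C : ℝ := 2 ^ p₂ / c with hC
  have hC0 : 0 < C := by positivity
  have hp1 : 1 < p := by linarith [hp.1]
  have hp0 : 0 < p := by linarith
  have key : ∀ a b s d : ℝ, 0 ≤ a → 0 ≤ b → 0 ≤ s → 0 ≤ d → b ≤ a →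
      s ≤ a + b → d ≤ a + b → (ε * a ≤ d → s ≤ (2 - δ) * a) →
      d ^ p + C * (s / 2) ^ p ≤ (ε + C / 2) * (a ^ p + b ^ p) := by
    intro a b s d ha hb hs hd hba hsab hdab himp
    have hap : 0 ≤ a ^ p := Real.rpow_nonneg ha p
    have hbp : 0 ≤ b ^ p := Real.rpow_nonneg hb p
    -- Here `a` is the larger of the two. If `d` is large, the gap is at least `c a^p` and its
    -- multiple absorbs `d^p`. If `d` is small, `d^p ≤ ε a^p` and the gap is nonnegative by midpoint
    -- convexity.
    by_cases h : ε * a ≤ d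
    · rcases ha.eq_or_lt with rfl | ha
      · obtain rfl : b = 0 := by linarith
        obtain rfl : s = 0 := by linarith
        obtain rfl : d = 0 := by linarith
        simp [Real.zero_rpow hp0.ne']
      · have ht0 : 0 ≤ b / a := by positivity
        have ht1 : b / a ≤ 1 := (div_le_one ha).2 hba
        have hg := hgap p hp (b / a) ⟨ht0, ht1⟩
        have hs2 : s / 2 ≤ a * min ((1 + b / a) / 2) (1 - δ / 2) := by
          rw [mul_min_of_nonneg _ _ ha.le]
          refine le_min ?_ (by linarith [himp h])
          have : a * ((1 + b / a) / 2) = (a + b) / 2 := by field_simp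
          linarith
        have hm0 : 0 ≤ min ((1 + b / a) / 2) (1 - δ / 2) :=
          le_min (by linarith) (by linarith)
        have hsp := Real.rpow_le_rpow (by linarith) hs2 hp0.le
        rw [Real.mul_rpow ha.le hm0] at hsp
        have hdp : d ^ p ≤ 2 ^ p₂ * a ^ p := by
          calc d ^ p ≤ (2 * a) ^ p := Real.rpow_le_rpow hd (by linarith) hp0.le
            _ = 2 ^ p * a ^ p := Real.mul_rpow (by norm_num) ha.le
            _ ≤ 2 ^ p₂ * a ^ p := by
              gcongr
              · norm_num
              · exact hp.2
        have hbdiv : a ^ p * (b / a) ^ p = b ^ p := by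
          rw [← Real.mul_rpow ha.le ht0, mul_div_cancel₀ _ ha.ne']
        have h1 := mul_le_mul_of_nonneg_left hg hap
        have h2 : c * a ^ p ≤ (a ^ p + b ^ p) / 2 - (s / 2) ^ p := by
          rw [← hbdiv]
          linarith
        have h3 := mul_le_mul_of_nonneg_left h2 hC0.le
        have h4 : C * (c * a ^ p) = 2 ^ p₂ * a ^ p := by
          rw [hC]
          field_simp
        nlinarith [mul_nonneg hε.le (add_nonneg hap hbp)]
    · have h1 : d ^ p ≤ ε * a ^ p := by
        calc d ^ p ≤ (ε * a) ^ p := Real.rpow_le_rpow hd (not_le.1 h).le hp0.le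
          _ = ε ^ p * a ^ p := Real.mul_rpow hε.le ha
          _ ≤ ε * a ^ p := by
            gcongr
            simpa using Real.rpow_le_rpow_of_exponent_ge hε hε1 hp1.le
      have h2 : (s / 2) ^ p ≤ (a ^ p + b ^ p) / 2 :=
        (Real.rpow_le_rpow (by positivity) (by linarith) hp0.le).trans
          (rpow_midpoint_le ha hb hp1.le)
      nlinarith [mul_nonneg hε.le hbp]
  intro a b s d ha hb hs hd hsab hdab himp
  rcases le_total b a with h | h
  · rw [max_eq_left h] at himp
    exact key a b s d ha hb hs hd h hsab hdab himp
  · rw [max_eq_right h] at himp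
    rw [add_comm (a ^ p)]
    exact key b a s d hb ha hs hd h (by linarith) (by linarith) himp

/-- Version of `exists_rpow_convexity_gap` for extended nonnegative reals. -/
theorem exists_ennreal_rpow_convexity_gap {p₁ p₂ ε δ : ℝ} (hp₁ : 1 < p₁) (hε : 0 < ε)
    (hε1 : ε ≤ 1) (hδ : 0 < δ) (hδ1 : δ ≤ 1) :
    ∃ C : ℝ, 0 < C ∧ ∀ p ∈ Set.Icc p₁ p₂, ∀ a b s d : ℝ≥0∞, s ≤ a + b → d ≤ a + b →
      (ENNReal.ofReal ε * max a b ≤ d → s ≤ ENNReal.ofReal (2 - δ) * max a b) →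
      d ^ p + ENNReal.ofReal C * (s / 2) ^ p ≤
        ENNReal.ofReal (ε + C / 2) * (a ^ p + b ^ p) := by
  obtain ⟨C, hC, h⟩ := exists_rpow_convexity_gap (p₂ := p₂) hp₁ hε hε1 hδ hδ1
  refine ⟨C, hC, fun p hp a b s d hs hd himp => ?_⟩
  have hp0 : 0 < p := by linarith [hp.1]
  have hcoef : ENNReal.ofReal (ε + C / 2) ≠ 0 := by
    simp only [ne_eq, ENNReal.ofReal_eq_zero, not_le]
    positivity
  rcases eq_or_ne a ∞ with rfl | ha
  · simp [ENNReal.top_rpow_of_pos hp0, ENNReal.mul_top hcoef]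
  rcases eq_or_ne b ∞ with rfl | hb
  · simp [ENNReal.top_rpow_of_pos hp0, ENNReal.mul_top hcoef]
  have hab : a + b ≠ ∞ := ENNReal.add_ne_top.2 ⟨ha, hb⟩
  have hs' : s ≠ ∞ := ne_top_of_le_ne_top hab hs
  have hd' : d ≠ ∞ := ne_top_of_le_ne_top hab hd
  lift a to NNReal using ha
  lift b to NNReal using hb
  lift s to NNReal using hs'
  lift d to NNReal using hd'
  have key := h p hp a b s d a.2 b.2 s.2 d.2 (by exact_mod_cast hs) (by exact_mod_cast hd) (by
    intro h1
    have h2 := himp (by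
      rw [← ENNReal.coe_max, ← ENNReal.ofReal_coe_nnreal, ← ENNReal.ofReal_mul hε.le,
        ← ENNReal.ofReal_coe_nnreal]
      exact ENNReal.ofReal_le_ofReal (by exact_mod_cast h1))
    rw [← ENNReal.coe_max, ← ENNReal.ofReal_coe_nnreal, ← ENNReal.ofReal_coe_nnreal,
      ← ENNReal.ofReal_mul (by linarith),
      ENNReal.ofReal_le_ofReal_iff (mul_nonneg (by linarith) NNReal.zero_le_coe)] at h2
    exact_mod_cast h2)
  have e2 : (s : ℝ≥0∞) / 2 = ENNReal.ofReal (s / 2) := by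
    rw [ENNReal.ofReal_div_of_pos two_pos, ENNReal.ofReal_coe_nnreal]
    simp
  rw [e2, ← ENNReal.ofReal_coe_nnreal (p := a), ← ENNReal.ofReal_coe_nnreal (p := b),
    ← ENNReal.ofReal_coe_nnreal (p := d), ENNReal.ofReal_rpow_of_nonneg a.coe_nonneg hp0.le,
    ENNReal.ofReal_rpow_of_nonneg b.coe_nonneg hp0.le, ENNReal.ofReal_rpow_of_nonneg d.coe_nonneg hp0.le,
    ENNReal.ofReal_rpow_of_nonneg (by positivity) hp0.le, ← ENNReal.ofReal_mul hC.le,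
    ← ENNReal.ofReal_add (by positivity) (by positivity),
    ← ENNReal.ofReal_add (by positivity) (by positivity), ← ENNReal.ofReal_mul (by positivity)]
  exact ENNReal.ofReal_le_ofReal key

/-- Bernoulli's inequality. It converts a gain `κ` in a modular or a `q`-th power into a gain `δ` in
the norm. -/
theorem exists_pos_le_one_sub_rpow {q κ : ℝ} (hq : 1 ≤ q) (hκ : 0 < κ) :
    ∃ δ : ℝ, 0 < δ ∧ δ ≤ 1 / 2 ∧ 1 - κ ≤ (1 - δ) ^ q := by
  refine ⟨min (1 / 2) (κ / q), by positivity, min_le_left _ _, ?_⟩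
  set δ := min (1 / 2) (κ / q)
  have h1 : δ ≤ 1 / 2 := min_le_left _ _
  have h2 : q * δ ≤ κ := by
    have : δ ≤ κ / q := min_le_right _ _
    rw [le_div_iff₀ (by linarith)] at this
    linarith
  have := one_add_mul_self_le_rpow_one_add (s := -δ) (by linarith) hq
  rw [← sub_eq_add_neg] at this
  linarith

/-! ### The Luxemburg norm of `L^{p(·)}` and the mixed norm as an `ℓ^q` norm of Luxemburg norms -/

section Luxemburg

variable {𝕜 : Type*} [RCLike 𝕜] {n : ℕ}

/-- The Luxemburg functional `inf {r > 0 : ϱ_{p(·)}(f / r) ≤ 1}` of `L^{p(·)}(ℝⁿ)`. -/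
noncomputable def luxemburg (p : EuclideanSpace ℝ (Fin n) → ℝ≥0∞)
    (f : EuclideanSpace ℝ (Fin n) → 𝕜) : ℝ≥0∞ :=
  ⨅ (r : ℝ) (_ : 0 < r) (_ : varModular p (fun x => r⁻¹ • f x) ≤ 1), ENNReal.ofReal r

theorem varModular_mono_norm {p : EuclideanSpace ℝ (Fin n) → ℝ≥0∞}
    {f g : EuclideanSpace ℝ (Fin n) → 𝕜} (h : ∀ x, ‖f x‖ ≤ ‖g x‖) :
    varModular p f ≤ varModular p g := by
  have h' : ∀ x, ‖f x‖ₑ ≤ ‖g x‖ₑ := fun x => by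
    rw [← ofReal_norm, ← ofReal_norm]
    exact ENNReal.ofReal_le_ofReal (h x)
  refine add_le_add (lintegral_mono fun x => ?_) (essSup_mono_ae (ae_of_all _ h'))
  exact ENNReal.rpow_le_rpow (h' x) ENNReal.toReal_nonneg

theorem luxemburg_congr_norm {p : EuclideanSpace ℝ (Fin n) → ℝ≥0∞}
    {f g : EuclideanSpace ℝ (Fin n) → 𝕜} (h : ∀ᵐ x, ‖f x‖ = ‖g x‖) :
    luxemburg p f = luxemburg p g := by
  have key : ∀ r : ℝ, varModular p (fun x => r⁻¹ • f x) =
      varModular p (fun x => r⁻¹ • g x) := by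
    intro r
    apply varModular_congr_norm
    filter_upwards [h] with x hx
    rw [norm_smul, norm_smul, hx]
  simp only [luxemburg, key]

theorem luxemburg_le {p : EuclideanSpace ℝ (Fin n) → ℝ≥0∞}
    {f : EuclideanSpace ℝ (Fin n) → 𝕜} {r : ℝ} (hr : 0 < r)
    (h : varModular p (fun x => r⁻¹ • f x) ≤ 1) : luxemburg p f ≤ ENNReal.ofReal r :=
  iInf_le_of_le r (iInf_le_of_le hr (iInf_le_of_le h le_rfl))

/-- An admissible radius below `r` exists, and enlarging the radius decreases the modular. The
strict inequality avoids having to show that the infimum is attained. -/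
theorem varModular_inv_smul_le_one {p : EuclideanSpace ℝ (Fin n) → ℝ≥0∞}
    {f : EuclideanSpace ℝ (Fin n) → 𝕜} {r : ℝ} (h : luxemburg p f < ENNReal.ofReal r) :
    varModular p (fun x => r⁻¹ • f x) ≤ 1 := by
  simp only [luxemburg, iInf_lt_iff] at h
  obtain ⟨s, hs, hfs, hsr⟩ := h
  have hsr' : s < r := (ENNReal.ofReal_lt_ofReal_iff_of_nonneg hs.le).1 hsr
  refine (varModular_mono_norm fun x => ?_).trans hfs
  rw [norm_smul, norm_smul, Real.norm_of_nonneg (inv_nonneg.2 (hs.trans hsr').le),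
    Real.norm_of_nonneg (inv_nonneg.2 hs.le)]
  gcongr

theorem luxemburg_zero (p : VariableExponent n) :
    luxemburg p.toFun (fun _ => (0 : 𝕜)) = 0 := by
  refine le_antisymm (ENNReal.le_of_forall_pos_le_add fun ε hε _ => ?_) zero_le
  rw [zero_add, ← ENNReal.ofReal_coe_nnreal]
  refine luxemburg_le (by exact_mod_cast hε) ?_
  simp only [smul_zero]
  rw [varModular_zero]
  exact zero_le_one

theorem luxemburg_smul (p : EuclideanSpace ℝ (Fin n) → ℝ≥0∞)
    (f : EuclideanSpace ℝ (Fin n) → 𝕜) {c : ℝ} (hc : 0 < c) :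
    luxemburg p (fun x => c • f x) = ENNReal.ofReal c * luxemburg p f := by
  -- One inequality suffices: the other follows by applying it to `c • f` with factor `c⁻¹`.
  have key : ∀ (f : EuclideanSpace ℝ (Fin n) → 𝕜) {c : ℝ}, 0 < c →
      luxemburg p (fun x => c • f x) ≤ ENNReal.ofReal c * luxemburg p f := by
    intro f c hc
    have hc' : ENNReal.ofReal c ≠ 0 := by simpa using hc
    conv_rhs => unfold luxemburg
    simp only [ENNReal.mul_iInf_of_ne hc' ENNReal.ofReal_ne_top, le_iInf_iff]
    intro r hr hf
    rw [← ENNReal.ofReal_mul hc.le]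
    refine luxemburg_le (by positivity) (le_trans (le_of_eq ?_) hf)
    congr 1
    funext x
    rw [smul_smul]
    congr 1
    field_simp
  refine le_antisymm (key f hc) ?_
  have h := key (fun x => c • f x) (inv_pos.2 hc)
  simp only [inv_smul_smul₀ hc.ne'] at h
  calc ENNReal.ofReal c * luxemburg p f
      ≤ ENNReal.ofReal c * (ENNReal.ofReal c⁻¹ * luxemburg p (fun x => c • f x)) := by gcongr
    _ = luxemburg p (fun x => c • f x) := by
      rw [← mul_assoc, ← ENNReal.ofReal_mul hc.le, mul_inv_cancel₀ hc.ne', ENNReal.ofReal_one,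
        one_mul]

theorem luxemburg_add_le (p : VariableExponent n) {f g : EuclideanSpace ℝ (Fin n) → 𝕜}
    (hf : AEStronglyMeasurable f) :
    luxemburg p.toFun (fun x => f x + g x) ≤ luxemburg p.toFun f + luxemburg p.toFun g := by
  conv_rhs => unfold luxemburg
  simp only [ENNReal.iInf_add, ENNReal.add_iInf, le_iInf_iff]
  intro s hs hgs r hr hfr
  rw [← ENNReal.ofReal_add hr.le hs.le]
  refine luxemburg_le (by positivity) ?_
  have hab : r / (r + s) + s / (r + s) = 1 := by field_simp
  have h := varModular_convex p (f := fun x => r⁻¹ • f x)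
    (g := fun x => s⁻¹ • g x) (hf.const_smul _) (a := r / (r + s))
    (b := s / (r + s)) (by positivity) (by positivity) hab.le
  have he : (fun x => (r + s)⁻¹ • (f x + g x)) =
      fun x => (r / (r + s)) • r⁻¹ • f x + (s / (r + s)) • s⁻¹ • g x := by
    funext x
    rw [smul_add, smul_smul, smul_smul]
    congr 2 <;> field_simp
  rw [he]
  refine h.trans ?_
  calc _ ≤ ENNReal.ofReal (r / (r + s)) * 1 + ENNReal.ofReal (s / (r + s)) * 1 := by gcongr
    _ = 1 := by
      rw [mul_one, mul_one, ← ENNReal.ofReal_add (by positivity) (by positivity), hab,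
        ENNReal.ofReal_one]

theorem luxemburg_sub_le (p : VariableExponent n) {f g : EuclideanSpace ℝ (Fin n) → 𝕜}
    (hf : AEStronglyMeasurable f) :
    luxemburg p.toFun (fun x => f x - g x) ≤ luxemburg p.toFun f + luxemburg p.toFun g := by
  have h := luxemburg_add_le p (g := fun x => - g x) hf
  rw [luxemburg_congr_norm (f := fun x => - g x) (g := g) (ae_of_all _ fun x => norm_neg _)] at h
  simpa only [sub_eq_add_neg] using h

/-- For constant finite `q`, the modular of `ℓ^q(L^{p(·)})` is the sum of the `q`-th powers of the
Luxemburg norms. -/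
theorem mixedModular_eq_tsum (p : EuclideanSpace ℝ (Fin n) → ℝ≥0∞) {q : ℝ≥0∞} (hq : 1 ≤ q)
    (hq' : q ≠ ∞) (f : ℕ → EuclideanSpace ℝ (Fin n) → 𝕜) :
    mixedModular p (fun _ => q) f = ∑' ν, luxemburg p (f ν) ^ q.toReal := by
  have hq0 : 0 < q.toReal := ENNReal.toReal_pos (by positivity) hq'
  unfold mixedModular
  congr 1
  funext ν
  simp only [ENNReal.toReal_inv]
  -- The power is an order isomorphism of `[0, ∞]` and so commutes with infima; the two infima then
  -- match under `t = r^q`.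
  have hpow : luxemburg p (f ν) ^ q.toReal = ⨅ (r : ℝ) (_ : 0 < r)
      (_ : varModular p (fun x => r⁻¹ • f ν x) ≤ 1), ENNReal.ofReal r ^ q.toReal := by
    have h := fun z : ℝ≥0∞ => ENNReal.orderIsoRpow_apply q.toReal hq0 z
    simp only [luxemburg, ← h, OrderIso.map_iInf]
  rw [hpow]
  refine le_antisymm (le_iInf fun r => le_iInf fun hr => le_iInf fun hf => ?_)
    (le_iInf fun t => le_iInf fun ht => le_iInf fun hf => ?_)
  · rw [ENNReal.ofReal_rpow_of_pos hr]
    refine iInf_le_of_le (r ^ q.toReal) (iInf_le_of_le (Real.rpow_pos_of_pos hr _)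
      (iInf_le_of_le ?_ le_rfl))
    rwa [Real.rpow_rpow_inv hr.le hq0.ne']
  · refine iInf_le_of_le (t ^ q.toReal⁻¹) (iInf_le_of_le (Real.rpow_pos_of_pos ht _)
      (iInf_le_of_le hf ?_))
    rw [ENNReal.ofReal_rpow_of_pos (Real.rpow_pos_of_pos ht _), Real.rpow_inv_rpow ht.le hq0.ne']

theorem mixedModular_smul (p : EuclideanSpace ℝ (Fin n) → ℝ≥0∞) {q : ℝ≥0∞} (hq : 1 ≤ q)
    (hq' : q ≠ ∞) (f : ℕ → EuclideanSpace ℝ (Fin n) → 𝕜) {c : ℝ} (hc : 0 < c) :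
    mixedModular p (fun _ => q) (fun ν x => c • f ν x) =
      ENNReal.ofReal (c ^ q.toReal) * mixedModular p (fun _ => q) f := by
  rw [mixedModular_eq_tsum p hq hq', mixedModular_eq_tsum p hq hq', ← ENNReal.tsum_mul_left]
  congr 1
  funext ν
  rw [luxemburg_smul p _ hc, ENNReal.mul_rpow_of_nonneg _ _ ENNReal.toReal_nonneg,
    ENNReal.ofReal_rpow_of_pos hc]

theorem MemMixed.mixedModular_ne_top {p : EuclideanSpace ℝ (Fin n) → ℝ≥0∞} {q : ℝ≥0∞}
    (hq : 1 ≤ q) (hq' : q ≠ ∞) {f : ℕ → EuclideanSpace ℝ (Fin n) → 𝕜}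
    (hf : MemMixed p (fun _ => q) f) : mixedModular p (fun _ => q) f ≠ ∞ := by
  obtain ⟨r, hr, h⟩ := hf
  rw [mixedModular_smul p hq hq' f (inv_pos.2 hr)] at h
  have h0 : ENNReal.ofReal (r⁻¹ ^ q.toReal) ≠ 0 := by
    simpa using Real.rpow_pos_of_pos (inv_pos.2 hr) _
  intro h'
  rw [h', ENNReal.mul_top h0] at h
  exact h.ne rfl

theorem mixedNorm_eq (p : EuclideanSpace ℝ (Fin n) → ℝ≥0∞) {q : ℝ≥0∞} (hq : 1 ≤ q)
    (hq' : q ≠ ∞) {f : ℕ → EuclideanSpace ℝ (Fin n) → 𝕜}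
    (hf : MemMixed p (fun _ => q) f) :
    mixedNorm p (fun _ => q) f = (mixedModular p (fun _ => q) f).toReal ^ q.toReal⁻¹ := by
  have hq0 : 0 < q.toReal := ENNReal.toReal_pos (by positivity) hq'
  have hS := hf.mixedModular_ne_top hq hq'
  set S := mixedModular p (fun _ => q) f with hSdef
  have ha : 0 ≤ S.toReal ^ q.toReal⁻¹ := by positivity
  have hset : ∀ r : ℝ, 0 < r → (mixedModular p (fun _ => q) (fun ν x => r⁻¹ • f ν x) ≤ 1 ↔
      S.toReal ^ q.toReal⁻¹ ≤ r) := by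
    intro r hr
    rw [mixedModular_smul p hq hq' f (inv_pos.2 hr), ← hSdef, ← ENNReal.ofReal_toReal hS,
      ← ENNReal.ofReal_mul (by positivity), ENNReal.ofReal_le_one, Real.inv_rpow hr.le,
      inv_mul_le_iff₀ (by positivity), mul_one, ENNReal.toReal_ofReal ENNReal.toReal_nonneg,
      Real.rpow_inv_le_iff_of_pos ENNReal.toReal_nonneg hr.le hq0]
  unfold mixedNorm
  -- The candidate value can be 0, which is not an admissible radius, hence the added `ε`.
  refine le_antisymm (le_of_forall_pos_le_add fun ε hε => ?_) (le_csInf ?_ ?_)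
  · exact csInf_le ⟨0, fun r hr => hr.1.le⟩
      ⟨by positivity, (hset _ (by positivity)).2 (by linarith)⟩
  · exact ⟨S.toReal ^ q.toReal⁻¹ + 1, by positivity, (hset _ (by positivity)).2 (by linarith)⟩
  · rintro r ⟨hr, h⟩
    exact (hset r hr).1 h

theorem ofReal_mixedNorm_rpow (p : EuclideanSpace ℝ (Fin n) → ℝ≥0∞) {q : ℝ≥0∞} (hq : 1 ≤ q)
    (hq' : q ≠ ∞) {f : ℕ → EuclideanSpace ℝ (Fin n) → 𝕜}
    (hf : MemMixed p (fun _ => q) f) :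
    ENNReal.ofReal (mixedNorm p (fun _ => q) f ^ q.toReal) =
      ∑' ν, luxemburg p (f ν) ^ q.toReal := by
  have hq0 : 0 < q.toReal := ENNReal.toReal_pos (by positivity) hq'
  rw [mixedNorm_eq p hq hq' hf, Real.rpow_inv_rpow ENNReal.toReal_nonneg hq0.ne',
    ENNReal.ofReal_toReal (hf.mixedModular_ne_top hq hq'), mixedModular_eq_tsum p hq hq']

end Luxemburg

/-! ### Uniform convexity: scalars, then `L^{p(·)}`, then the mixed space -/

/-- The scalar field is a real inner product space, hence uniformly convex; dividing by the larger
norm reduces to the closed unit ball. This homogeneous form is the one that the scalar inequality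
takes as hypothesis. -/
theorem RCLike.exists_enorm_add_le {𝕜 : Type*} [RCLike 𝕜] {ε : ℝ} (hε : 0 < ε) :
    ∃ δ : ℝ, 0 < δ ∧ δ ≤ 1 ∧ ∀ a b : 𝕜, ENNReal.ofReal ε * max ‖a‖ₑ ‖b‖ₑ ≤ ‖a - b‖ₑ →
      ‖a + b‖ₑ ≤ ENNReal.ofReal (2 - δ) * max ‖a‖ₑ ‖b‖ₑ := by
  have hUC : UniformConvexSpace 𝕜 :=
    letI : InnerProductSpace ℝ 𝕜 := InnerProductSpace.rclikeToReal 𝕜 𝕜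
    InnerProductSpace.toUniformConvexSpace
  obtain ⟨δ, hδ, h⟩ := exists_forall_closed_ball_dist_add_le_two_sub 𝕜 hε
  refine ⟨min δ 1, by positivity, min_le_right _ _, fun a b hab => ?_⟩
  have hδ2 : 0 ≤ 2 - min δ 1 := by linarith [min_le_right δ 1]
  simp only [← ofReal_norm] at hab ⊢
  rw [← ENNReal.ofReal_max, ← ENNReal.ofReal_mul hε.le,
    ENNReal.ofReal_le_ofReal_iff (norm_nonneg _)] at hab
  rw [← ENNReal.ofReal_max, ← ENNReal.ofReal_mul hδ2]
  apply ENNReal.ofReal_le_ofReal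
  set m := max ‖a‖ ‖b‖ with hm
  have ham : ‖a‖ ≤ m := le_max_left _ _
  have hbm : ‖b‖ ≤ m := le_max_right _ _
  rcases (le_max_of_le_left (norm_nonneg a) : 0 ≤ m).eq_or_lt with h0 | h0
  · have ha : a = 0 := norm_le_zero_iff.1 (by linarith)
    have hb : b = 0 := norm_le_zero_iff.1 (by linarith)
    rw [show m = 0 from h0.symm, ha, hb]
    simp
  · have hn : ∀ z : 𝕜, ‖m⁻¹ • z‖ = ‖z‖ / m := fun z => by
      rw [norm_smul, Real.norm_of_nonneg (inv_nonneg.2 h0.le), inv_mul_eq_div]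
    have h1 := h (x := m⁻¹ • a) (by rw [hn]; exact (div_le_one h0).2 ham)
      (y := m⁻¹ • b) (by rw [hn]; exact (div_le_one h0).2 hbm)
      (by rw [← smul_sub, hn]; exact (le_div_iff₀ h0).2 hab)
    rw [← smul_add, hn, div_le_iff₀ h0] at h1
    exact h1.trans (by gcongr; exact min_le_left _ _)

namespace VariableExponent

variable {n : ℕ}

theorem exists_bounds (p : VariableExponent n) (h1 : 1 < p.lower) (h2 : p.upper < ∞) :
    ∃ p₁ p₂ : ℝ, 1 < p₁ ∧ p₁ ≤ p₂ ∧
      ∀ᵐ x, p.toFun x ≠ ∞ ∧ (p.toFun x).toReal ∈ Set.Icc p₁ p₂ := by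
  have hlow : ∀ᵐ x, p.lower ≤ p.toFun x := ae_essInf_le
  have hup : ∀ᵐ x, p.toFun x ≤ p.upper := ENNReal.ae_le_essSup p.toFun
  -- Lebesgue measure is nonzero, so some point satisfies both bounds; this yields `p₋ ≤ p₊`, hence
  -- `p₋ < ∞`.
  obtain ⟨x, hx1, hx2⟩ := (hlow.and hup).exists
  have hlu : p.lower ≤ p.upper := hx1.trans hx2
  have hl : p.lower ≠ ∞ := (hlu.trans_lt h2).ne
  refine ⟨p.lower.toReal, p.upper.toReal, ?_, ENNReal.toReal_mono h2.ne hlu, ?_⟩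
  · simpa using (ENNReal.toReal_lt_toReal ENNReal.one_ne_top hl).2 h1
  · filter_upwards [hlow, hup] with x hx1 hx2
    have hx : p.toFun x ≠ ∞ := (hx2.trans_lt h2).ne
    exact ⟨hx, ENNReal.toReal_mono hx hx1, ENNReal.toReal_mono h2.ne hx2⟩

end VariableExponent

section UniformConvexity

variable {𝕜 : Type*} [RCLike 𝕜] {n : ℕ}

theorem varModular_eq_lintegral {p : VariableExponent n} (hp : ∀ᵐ x, p.toFun x ≠ ∞)
    (f : EuclideanSpace ℝ (Fin n) → 𝕜) :
    varModular p.toFun f = ∫⁻ x, ‖f x‖ₑ ^ (p.toFun x).toReal := by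
  have h1 : volume.restrict {x | p.toFun x = ∞} = 0 := by
    rw [Measure.restrict_eq_zero]
    simpa [ae_iff] using hp
  have h2 : volume.restrict {x | p.toFun x ≠ ∞} = volume := by
    rw [Measure.restrict_congr_set (t := Set.univ) (by
      filter_upwards [hp] with x hx
      exact eq_true hx), Measure.restrict_univ]
  rw [varModular, h1, h2, eLpNormEssSup_measure_zero, add_zero]

/-- For `k ≤ 1` and `p(x) ≤ p₂`, `k^{-p(x)} ≤ k^{-p₂}`. So a modular at most `k^p₂` forces the
Luxemburg norm to be at most `k`: this is where boundedness of the exponent enters. -/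
theorem varModular_inv_smul_le {p : VariableExponent n} {p₂ : ℝ}
    (hp : ∀ᵐ x, p.toFun x ≠ ∞ ∧ (p.toFun x).toReal ≤ p₂)
    (f : EuclideanSpace ℝ (Fin n) → 𝕜) {k : ℝ} (hk : 0 < k) (hk1 : k ≤ 1) :
    varModular p.toFun (fun x => k⁻¹ • f x) ≤
      ENNReal.ofReal (k ^ p₂)⁻¹ * varModular p.toFun f := by
  have hfin : ∀ᵐ x, p.toFun x ≠ ∞ := hp.mono fun x hx => hx.1
  rw [varModular_eq_lintegral hfin, varModular_eq_lintegral hfin,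
    ← lintegral_const_mul' _ _ ENNReal.ofReal_ne_top]
  apply lintegral_mono_ae
  filter_upwards [hp] with x hx
  rw [enorm_smul, ENNReal.mul_rpow_of_nonneg _ _ ENNReal.toReal_nonneg,
    Real.enorm_of_nonneg (inv_nonneg.2 hk.le), ENNReal.ofReal_rpow_of_pos (inv_pos.2 hk),
    Real.inv_rpow hk.le]
  gcongr ENNReal.ofReal ?_ * _
  exact inv_anti₀ (Real.rpow_pos_of_pos hk _) (Real.rpow_le_rpow_of_exponent_ge hk hk1 hx.2)

/-- The modular of `L^{p(·)}` is uniformly convex. -/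
theorem exists_varModular_convexity_gap (𝕜 : Type*) [RCLike 𝕜] {p : VariableExponent n}
    {p₁ p₂ : ℝ} (hp₁ : 1 < p₁)
    (hp : ∀ᵐ x, p.toFun x ≠ ∞ ∧ (p.toFun x).toReal ∈ Set.Icc p₁ p₂) {ε : ℝ} (hε : 0 < ε)
    (hε1 : ε ≤ 1) :
    ∃ C : ℝ, 0 < C ∧ ∀ f g : EuclideanSpace ℝ (Fin n) → 𝕜, AEStronglyMeasurable f →
      AEStronglyMeasurable g →
      varModular p.toFun (fun x => f x - g x) +
        ENNReal.ofReal C * varModular p.toFun (fun x => (2⁻¹ : ℝ) • (f x + g x)) ≤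
      ENNReal.ofReal (ε + C / 2) * (varModular p.toFun f + varModular p.toFun g) := by
  obtain ⟨δ, hδ, hδ1, hUC⟩ := RCLike.exists_enorm_add_le (𝕜 := 𝕜) hε
  obtain ⟨C, hC, h⟩ := exists_ennreal_rpow_convexity_gap (p₂ := p₂) hp₁ hε hε1 hδ hδ1
  refine ⟨C, hC, fun f g hf hg => ?_⟩
  have hfin : ∀ᵐ x, p.toFun x ≠ ∞ := hp.mono fun x hx => hx.1
  have hmeas : ∀ {u : EuclideanSpace ℝ (Fin n) → 𝕜}, AEStronglyMeasurable u →
      AEMeasurable fun x => ‖u x‖ₑ ^ (p.toFun x).toReal := fun hu =>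
    hu.enorm.pow p.measurable_toFun.ennreal_toReal.aemeasurable
  simp only [varModular_eq_lintegral hfin]
  rw [← lintegral_const_mul' _ _ ENNReal.ofReal_ne_top, ← lintegral_add_left' (hmeas (u := fun x => f x - g x) (hf.sub hg)),
    ← lintegral_add_left' (hmeas hf), ← lintegral_const_mul' _ _ ENNReal.ofReal_ne_top]
  apply lintegral_mono_ae
  filter_upwards [hp] with x hx
  have h2 : ‖(2⁻¹ : ℝ) • (f x + g x)‖ₑ = ‖f x + g x‖ₑ / 2 := by
    rw [enorm_smul, Real.enorm_of_nonneg (by norm_num), ENNReal.ofReal_inv_of_pos two_pos,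
      ENNReal.div_eq_inv_mul]
    simp
  rw [h2]
  exact h _ hx.2 _ _ _ _ (enorm_add_le _ _) (enorm_sub_le) (hUC _ _)

/-- `L^{p(·)}` is uniformly convex when `1 < p₋ ≤ p₊ < ∞`. -/
theorem exists_luxemburg_add_le (𝕜 : Type*) [RCLike 𝕜] (p : VariableExponent n)
    (h1 : 1 < p.lower) (h2 : p.upper < ∞) {ε : ℝ} (hε : 0 < ε) (hε1 : ε ≤ 1) :
    ∃ δ : ℝ, 0 < δ ∧ δ ≤ 1 ∧ ∀ f g : EuclideanSpace ℝ (Fin n) → 𝕜, AEStronglyMeasurable f →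
      AEStronglyMeasurable g →
      ENNReal.ofReal ε * max (luxemburg p.toFun f) (luxemburg p.toFun g) ≤
        luxemburg p.toFun (fun x => f x - g x) →
      luxemburg p.toFun (fun x => f x + g x) ≤
        ENNReal.ofReal (2 - δ) * max (luxemburg p.toFun f) (luxemburg p.toFun g) := by
  obtain ⟨p₁, p₂, hp₁, hp₁₂, hp⟩ := p.exists_bounds h1 h2
  have hp' : ∀ᵐ x, p.toFun x ≠ ∞ ∧ (p.toFun x).toReal ≤ p₂ := hp.mono fun x hx => ⟨hx.1, hx.2.2⟩
  set k : ℝ := ε / 4 with hk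
  have hk0 : 0 < k := by positivity
  set c : ℝ := k ^ p₂ with hc
  have hc0 : 0 < c := Real.rpow_pos_of_pos hk0 _
  have hc1 : c ≤ 1 := Real.rpow_le_one hk0.le (by linarith) (by linarith)
  -- With both modulars at most 1, slack `c / 4` costs at most `c / 2`, half of the lower bound `c`
  -- for the modular of the difference. The remaining `c / 2`, divided by `C`, is the gain `κ`
  -- below.
  obtain ⟨C, hC, hgap⟩ := exists_varModular_convexity_gap 𝕜 hp₁ hp (ε := c / 4)
    (by positivity) (by linarith)
  obtain ⟨δ, hδ, hδ1, hpow⟩ := exists_pos_le_one_sub_rpow (q := p₂) (κ := c / (2 * C))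
    (by linarith) (by positivity)
  refine ⟨2 * δ, by positivity, by linarith, fun f g hf hg hfg => ?_⟩
  set M := max (luxemburg p.toFun f) (luxemburg p.toFun g) with hM
  have hadd : luxemburg p.toFun (fun x => f x + g x) ≤ M + M :=
    (luxemburg_add_le p hf).trans (add_le_add (le_max_left _ _) (le_max_right _ _))
  rcases eq_or_ne M ∞ with hMt | hMt
  · rw [hMt, ENNReal.mul_top (by simp; linarith)]
    exact le_top
  rcases eq_or_ne M 0 with hM0 | hM0
  · rw [hM0, add_zero] at hadd
    exact hadd.trans zero_le
  set m := M.toReal with hm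
  have hMm : M = ENNReal.ofReal m := (ENNReal.ofReal_toReal hMt).symm
  have hm0 : 0 < m := ENNReal.toReal_pos hM0 hMt
  -- Normalising by `r > m` makes the modulars of `f / r` and `g / r` at most 1; at the end `r`
  -- decreases to `m`.
  have key : ∀ r : ℝ, m < r → r < 2 * m →
      luxemburg p.toFun (fun x => f x + g x) ≤ ENNReal.ofReal ((2 - 2 * δ) * r) := by
    intro r hmr hr2
    have hr : 0 < r := hm0.trans hmr
    have hMr : M < ENNReal.ofReal r := by
      rw [hMm]
      exact (ENNReal.ofReal_lt_ofReal_iff hr).2 hmr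
    have hf1 := varModular_inv_smul_le_one ((le_max_left _ _).trans_lt hMr)
    have hg1 := varModular_inv_smul_le_one ((le_max_right _ _).trans_lt hMr)
    -- Otherwise the norm of `f - g` would be at most `r ε / 4 < ε m / 2`, using `r < 2 m`, against
    -- the assumed separation `ε m`.
    have hd : ENNReal.ofReal c ≤ varModular p.toFun (fun x => r⁻¹ • f x - r⁻¹ • g x) := by
      by_contra hlt
      have h3 := varModular_inv_smul_le hp' (fun x => r⁻¹ • f x - r⁻¹ • g x) hk0 (by linarith)
      have h4 : luxemburg p.toFun (fun x => r⁻¹ • f x - r⁻¹ • g x) ≤ ENNReal.ofReal k := by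
        refine luxemburg_le hk0 (h3.trans ?_)
        calc _ ≤ ENNReal.ofReal (k ^ p₂)⁻¹ * ENNReal.ofReal c := by
              gcongr
              exact (not_le.1 hlt).le
          _ = 1 := by
            rw [← ENNReal.ofReal_mul (by positivity), inv_mul_cancel₀ hc0.ne', ENNReal.ofReal_one]
      simp only [← smul_sub] at h4
      rw [luxemburg_smul _ _ (inv_pos.2 hr)] at h4
      have h5 : ENNReal.ofReal (r⁻¹ * (ε * m)) ≤ ENNReal.ofReal k := by
        refine le_trans ?_ h4
        rw [ENNReal.ofReal_mul (by positivity), ENNReal.ofReal_mul hε.le, ← hMm]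
        gcongr
      rw [ENNReal.ofReal_le_ofReal_iff hk0.le, inv_mul_le_iff₀ hr, hk] at h5
      nlinarith
    have hG := hgap (fun x => r⁻¹ • f x) (fun x => r⁻¹ • g x) (hf.const_smul _) (hg.const_smul _)
    set ρ := varModular p.toFun (fun x => (2⁻¹ : ℝ) • (r⁻¹ • f x + r⁻¹ • g x)) with hρ
    have hG2 : ENNReal.ofReal c + ENNReal.ofReal C * ρ ≤ ENNReal.ofReal (c / 2 + C) := by
      calc _ ≤ _ := add_le_add_left hd _
        _ ≤ _ := hG
        _ ≤ ENNReal.ofReal (c / 4 + C / 2) * (1 + 1) := by gcongr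
        _ = ENNReal.ofReal (c / 2 + C) := by
          rw [one_add_one_eq_two, ← ENNReal.ofReal_ofNat, ← ENNReal.ofReal_mul (by positivity)]
          congr 1
          ring
    have hρle : ρ ≤ ENNReal.ofReal ((1 - δ) ^ p₂) := by
      have hCρ : ENNReal.ofReal C * ρ ≠ ∞ :=
        ne_top_of_le_ne_top ENNReal.ofReal_ne_top (le_add_self.trans hG2)
      have hρt : ρ ≠ ∞ := by
        rintro h
        rw [h, ENNReal.mul_top (by simpa using hC)] at hCρ
        exact hCρ rfl
      rw [← ENNReal.ofReal_toReal hρt, ← ENNReal.ofReal_mul hC.le,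
        ← ENNReal.ofReal_add hc0.le (by positivity),
        ENNReal.ofReal_le_ofReal_iff (by positivity)] at hG2
      rw [← ENNReal.ofReal_toReal hρt]
      refine ENNReal.ofReal_le_ofReal (le_trans ?_ hpow)
      have : c / (2 * C) = c / 2 / C := by ring
      rw [this, le_sub_iff_add_le, ← le_sub_iff_add_le', div_le_iff₀ hC]
      linarith
    have hδ0 : 0 < 1 - δ := by linarith
    have h6 : luxemburg p.toFun (fun x => (2⁻¹ : ℝ) • (r⁻¹ • f x + r⁻¹ • g x)) ≤
        ENNReal.ofReal (1 - δ) := by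
      refine luxemburg_le hδ0 ((varModular_inv_smul_le hp' _ hδ0 (by linarith)).trans ?_)
      calc _ ≤ ENNReal.ofReal ((1 - δ) ^ p₂)⁻¹ * ENNReal.ofReal ((1 - δ) ^ p₂) := by gcongr
        _ = 1 := by
          rw [← ENNReal.ofReal_mul (by positivity), inv_mul_cancel₀ (by positivity),
            ENNReal.ofReal_one]
    have h7 := luxemburg_smul p.toFun
      (fun x => (2⁻¹ : ℝ) • (r⁻¹ • f x + r⁻¹ • g x)) (c := 2 * r) (by positivity)
    have h8 : (fun x => (2 * r) • (2⁻¹ : ℝ) • (r⁻¹ • f x + r⁻¹ • g x)) =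
        fun x => f x + g x := by
      funext x
      rw [← smul_add, smul_smul, smul_smul]
      have : 2 * r * 2⁻¹ * r⁻¹ = 1 := by field_simp
      rw [this, one_smul]
    rw [h8] at h7
    rw [h7]
    calc _ ≤ ENNReal.ofReal (2 * r) * ENNReal.ofReal (1 - δ) := by gcongr
      _ = _ := by
        rw [← ENNReal.ofReal_mul (by positivity)]
        congr 1
        ring
  have hv : luxemburg p.toFun (fun x => f x + g x) ≠ ∞ :=
    ne_top_of_le_ne_top (by simp [hMt]) hadd
  rw [hMm, ← ENNReal.ofReal_mul (by linarith), ← ENNReal.ofReal_toReal hv]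
  rw [← ENNReal.ofReal_toReal hv] at key
  set v := (luxemburg p.toFun (fun x => f x + g x)).toReal
  apply ENNReal.ofReal_le_ofReal
  by_contra! hlt
  have hδ2 : 0 < 2 - 2 * δ := by linarith
  obtain ⟨r, hmr, hr⟩ := exists_between (show m < min (2 * m) (v / (2 - 2 * δ)) from
    lt_min (by linarith) ((lt_div_iff₀ hδ2).2 (by linarith)))
  have h9 := key r hmr (hr.trans_le (min_le_left _ _))
  have h10 := (lt_div_iff₀ hδ2).1 (hr.trans_le (min_le_right _ _))
  rw [ENNReal.ofReal_le_ofReal_iff (by have := hm0.trans hmr; positivity)] at h9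
  linarith

variable {p : VariableExponent n} {q : ℝ≥0∞} [hq : Fact (1 ≤ q)]

theorem MixedSpace.ofReal_norm_rpow (hq' : q ≠ ∞) (f : MixedSpace 𝕜 p q) :
    ENNReal.ofReal (‖f‖ ^ q.toReal) = ∑' ν, luxemburg p.toFun ⇑(f.1 ν) ^ q.toReal :=
  ofReal_mixedNorm_rpow p.toFun hq.out hq' f.2

theorem MixedSpace.luxemburg_coe_add (f g : MixedSpace 𝕜 p q) (ν : ℕ) :
    luxemburg p.toFun ⇑((f + g).1 ν) = luxemburg p.toFun (fun x => f.1 ν x + g.1 ν x) := by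
  apply luxemburg_congr_norm
  filter_upwards [AEEqFun.coeFn_add (f.1 ν) (g.1 ν)] with x hx
  exact congrArg norm hx

theorem MixedSpace.luxemburg_coe_sub (f g : MixedSpace 𝕜 p q) (ν : ℕ) :
    luxemburg p.toFun ⇑((f - g).1 ν) = luxemburg p.toFun (fun x => f.1 ν x - g.1 ν x) := by
  apply luxemburg_congr_norm
  filter_upwards [AEEqFun.coeFn_sub (f.1 ν) (g.1 ν)] with x hx
  exact congrArg norm hx

/-- The scalar inequality on the degenerate exponent interval `[q, q]`, applied to the Luxemburg
norms at each index and summed. Its convexity hypothesis is `exists_luxemburg_add_le`. -/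
theorem MixedSpace.exists_norm_convexity_gap (𝕜 : Type*) [RCLike 𝕜] (hq1 : 1 < q)
    (hq' : q ≠ ∞) (h1 : 1 < p.lower) (h2 : p.upper < ∞) {ε : ℝ} (hε : 0 < ε) (hε1 : ε ≤ 1) :
    ∃ C : ℝ, 0 < C ∧ ∀ f g : MixedSpace 𝕜 p q,
      ‖f - g‖ ^ q.toReal + C * (‖f + g‖ / 2) ^ q.toReal ≤
        (ε + C / 2) * (‖f‖ ^ q.toReal + ‖g‖ ^ q.toReal) := by
  have hqr : 1 < q.toReal := by
    simpa using (ENNReal.toReal_lt_toReal ENNReal.one_ne_top hq').2 hq1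
  obtain ⟨δ, hδ, hδ1, hUC⟩ := exists_luxemburg_add_le 𝕜 p h1 h2 hε hε1
  obtain ⟨C, hC, h⟩ := exists_ennreal_rpow_convexity_gap (p₂ := q.toReal) hqr hε hε1 hδ hδ1
  refine ⟨C, hC, fun f g => ?_⟩
  have hsum : ENNReal.ofReal (‖f - g‖ ^ q.toReal) +
      ENNReal.ofReal C * (ENNReal.ofReal (‖f + g‖ ^ q.toReal) / 2 ^ q.toReal) ≤
      ENNReal.ofReal (ε + C / 2) *
        (ENNReal.ofReal (‖f‖ ^ q.toReal) + ENNReal.ofReal (‖g‖ ^ q.toReal)) := by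
    simp only [MixedSpace.ofReal_norm_rpow hq', div_eq_mul_inv]
    rw [← ENNReal.tsum_mul_right, ← ENNReal.tsum_mul_left, ← ENNReal.tsum_add,
      ← ENNReal.tsum_add, ← ENNReal.tsum_mul_left]
    refine ENNReal.tsum_le_tsum fun ν => ?_
    have hf := (f.1 ν).aestronglyMeasurable
    have hg := (g.1 ν).aestronglyMeasurable
    rw [MixedSpace.luxemburg_coe_add, MixedSpace.luxemburg_coe_sub, ← div_eq_mul_inv,
      ← ENNReal.div_rpow_of_nonneg _ _ (by linarith)]
    exact h _ ⟨le_rfl, le_rfl⟩ _ _ _ _ (luxemburg_add_le p hf) (luxemburg_sub_le p hf)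
      (hUC _ _ hf hg)
  have e2 : ENNReal.ofReal (‖f + g‖ ^ q.toReal) / 2 ^ q.toReal =
      ENNReal.ofReal ((‖f + g‖ / 2) ^ q.toReal) := by
    rw [Real.div_rpow (norm_nonneg _) two_pos.le, ENNReal.ofReal_div_of_pos (by positivity),
      ← ENNReal.ofReal_rpow_of_pos two_pos, ENNReal.ofReal_ofNat]
  rw [e2, ← ENNReal.ofReal_mul hC.le, ← ENNReal.ofReal_add (by positivity) (by positivity),
    ← ENNReal.ofReal_add (by positivity) (by positivity), ← ENNReal.ofReal_mul (by positivity),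
    ENNReal.ofReal_le_ofReal_iff (by positivity)] at hsum
  exact hsum

theorem MixedSpace.uniformConvexSpace (hq1 : 1 < q) (hq' : q ≠ ∞) (h1 : 1 < p.lower)
    (h2 : p.upper < ∞) : UniformConvexSpace (MixedSpace 𝕜 p q) := by
  refine ⟨fun ε₀ hε₀ => ?_⟩
  have hqr : 1 < q.toReal := by
    simpa using (ENNReal.toReal_lt_toReal ENNReal.one_ne_top hq').2 hq1
  have hqr0 : 0 < q.toReal := by linarith
  set ε : ℝ := min ε₀ 1 with hε
  have hε0 : 0 < ε := by positivity
  have hε1 : ε ≤ 1 := min_le_right _ _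
  set c : ℝ := ε ^ q.toReal with hc
  have hc0 : 0 < c := Real.rpow_pos_of_pos hε0 _
  have hc1 : c ≤ 1 := Real.rpow_le_one hε0.le hε1 hqr0.le
  -- The same bookkeeping as for `L^{p(·)}`: `c + C (‖x + y‖ / 2)^q ≤ c / 2 + C`, so the `q`-th
  -- power of the midpoint norm is at most `1 - c / (2 C)`.
  obtain ⟨C, hC, hgap⟩ := MixedSpace.exists_norm_convexity_gap 𝕜 hq1 hq' h1 h2 (ε := c / 4)
    (by positivity) (by linarith)
  obtain ⟨δ, hδ, hδ1, hpow⟩ := exists_pos_le_one_sub_rpow (q := q.toReal) (κ := c / (2 * C))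
    hqr.le (by positivity)
  refine ⟨2 * δ, by positivity, fun x hx y hy hxy => ?_⟩
  have hg := hgap x y
  rw [hx, hy, Real.one_rpow] at hg
  have hcle : c ≤ ‖x - y‖ ^ q.toReal :=
    Real.rpow_le_rpow hε0.le ((min_le_left _ _).trans hxy) hqr0.le
  have hle : (‖x + y‖ / 2) ^ q.toReal ≤ (1 - δ) ^ q.toReal := by
    refine le_trans ?_ hpow
    have : c / (2 * C) = c / 2 / C := by ring
    rw [this, le_sub_iff_add_le, ← le_sub_iff_add_le', div_le_iff₀ hC]
    linarith
  have := (Real.rpow_le_rpow_iff (by positivity) (by linarith) hqr0).1 hle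
  linarith

end UniformConvexity

/-! ### Failure of uniform convexity for `q = ∞` and `q = 1` -/

theorem not_uniformConvexSpace_of_norm_add_sub {𝕜 E : Type*} [RCLike 𝕜] [NormedAddCommGroup E]
    [NormedSpace 𝕜 E] {x y : E} (hx : x ≠ 0) (hxy : ‖x‖ = ‖y‖) (hadd : ‖x + y‖ = 2 * ‖x‖)
    (hsub : ‖x - y‖ = 2 * ‖x‖) : ¬ UniformConvexSpace E := by
  intro hE
  obtain ⟨δ, hδ, h⟩ := hE.uniform_convex two_pos
  have hc : ‖x‖ ≠ 0 := norm_ne_zero_iff.2 hx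
  have hn : ∀ z : E, ‖((‖x‖⁻¹ : ℝ) : 𝕜) • z‖ = ‖x‖⁻¹ * ‖z‖ := fun z => by
    rw [norm_smul, RCLike.norm_ofReal, abs_of_nonneg (by positivity)]
  have h2 : ‖x‖⁻¹ * (2 * ‖x‖) = 2 := by field_simp
  have h3 := h (x := ((‖x‖⁻¹ : ℝ) : 𝕜) • x) (by rw [hn, inv_mul_cancel₀ hc])
    (y := ((‖x‖⁻¹ : ℝ) : 𝕜) • y) (by rw [hn, ← hxy, inv_mul_cancel₀ hc])
    (by rw [← smul_sub, hn, hsub, h2])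
  rw [← smul_add, hn, hadd, h2] at h3
  linarith

section Counterexamples

variable {𝕜 : Type*} [RCLike 𝕜] {n : ℕ}

theorem exists_ne_zero_varModular_le_one (𝕜 : Type*) [RCLike 𝕜] (p : VariableExponent n) :
    ∃ F : EuclideanSpace ℝ (Fin n) →ₘ[volume] 𝕜, F ≠ 0 ∧ varModular p.toFun F ≤ 1 := by
  set B : Set (EuclideanSpace ℝ (Fin n)) := Metric.ball 0 1 with hB
  have hBm : MeasurableSet B := measurableSet_ball
  have hBt : volume B ≠ ∞ := measure_ball_lt_top.ne
  set V : ℝ := (volume B).toReal with hV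
  have hV0 : 0 ≤ V := ENNReal.toReal_nonneg
  -- As `a ≤ 1 ≤ p`, the integral part is at most `a V` and the supremum part at most `a`; the
  -- choice makes `a V + a = 1`.
  set a : ℝ := (V + 1)⁻¹ with ha
  have ha0 : 0 < a := by positivity
  have ha1 : a ≤ 1 := inv_le_one_of_one_le₀ (by linarith)
  set φ : EuclideanSpace ℝ (Fin n) → 𝕜 := B.indicator fun _ => (a : 𝕜) with hφ
  have hφm : AEStronglyMeasurable φ volume :=
    (stronglyMeasurable_const.indicator hBm).aestronglyMeasurable
  have hnorm : ∀ x, ‖φ x‖ₑ = B.indicator (fun _ => ENNReal.ofReal a) x := fun x => by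
    rw [hφ, enorm_indicator_eq_indicator_enorm, ← ofReal_norm, RCLike.norm_ofReal,
      abs_of_pos ha0]
  have haE : ENNReal.ofReal a ≤ 1 := ENNReal.ofReal_le_one.2 ha1
  have hpm : MeasurableSet {x | p.toFun x ≠ ∞} :=
    p.measurable_toFun (measurableSet_singleton ∞).compl
  refine ⟨AEEqFun.mk φ hφm, fun h0 => ?_, ?_⟩
  · have h1 : φ =ᵐ[volume] 0 := by
      rw [← AEEqFun.mk_eq_mk (hf := hφm) (hg := aestronglyMeasurable_zero)]
      exact h0
    have h2 : volume B = 0 := by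
      rw [← compl_mem_ae_iff]
      filter_upwards [h1] with x hx hxB
      rw [hφ, Set.indicator_of_mem hxB] at hx
      simp [ha0.ne'] at hx
    exact (Metric.measure_ball_pos volume 0 one_pos).ne' h2
  · rw [varModular_congr_norm (g := φ) ((AEEqFun.coeFn_mk φ hφm).mono fun x hx => by rw [hx])]
    have h1 : (∫⁻ x in {x | p.toFun x ≠ ∞}, ‖φ x‖ₑ ^ (p.toFun x).toReal) ≤
        ENNReal.ofReal a * volume B := by
      calc _ ≤ ∫⁻ x in {x | p.toFun x ≠ ∞}, B.indicator (fun _ => ENNReal.ofReal a) x := by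
            apply setLIntegral_mono_ae' hpm
            filter_upwards [p.one_le] with x hx hx'
            have hp1 : 1 ≤ (p.toFun x).toReal := by simpa using ENNReal.toReal_mono hx' hx
            rw [hnorm]
            by_cases hxB : x ∈ B
            · rw [Set.indicator_of_mem hxB]
              simpa using ENNReal.rpow_le_rpow_of_exponent_ge haE hp1
            · rw [Set.indicator_of_notMem hxB, ENNReal.zero_rpow_of_pos (by linarith)]
        _ ≤ ∫⁻ x, B.indicator (fun _ => ENNReal.ofReal a) x := setLIntegral_le_lintegral _ _
        _ = ENNReal.ofReal a * volume B := by
          rw [lintegral_indicator hBm, setLIntegral_const]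
    have h2 : eLpNormEssSup φ (volume.restrict {x | p.toFun x = ∞}) ≤ ENNReal.ofReal a := by
      refine essSup_le_of_ae_le _ (ae_of_all _ fun x => ?_)
      simp only [hnorm]
      exact Set.indicator_le_self' (fun _ _ => zero_le) x
    refine (add_le_add h1 h2).trans ?_
    rw [← ENNReal.ofReal_toReal hBt, ← hV, ← ENNReal.ofReal_mul ha0.le,
      ← ENNReal.ofReal_add (by positivity) ha0.le]
    apply ENNReal.ofReal_le_one.2
    rw [ha]
    apply le_of_eq
    field_simp

/-- Since `t^{1/∞} = 1`, the condition on `t` does not involve `t`: each summand is 0 if the modular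
is at most 1, and `inf ∅ = ∞` otherwise. -/
theorem mixedModular_top_le_one_iff (p : EuclideanSpace ℝ (Fin n) → ℝ≥0∞)
    (f : ℕ → EuclideanSpace ℝ (Fin n) → 𝕜) :
    mixedModular p (fun _ => ∞) f ≤ 1 ↔ ∀ ν, varModular p (f ν) ≤ 1 := by
  simp only [mixedModular, ENNReal.inv_top, ENNReal.toReal_zero, Real.rpow_zero, inv_one,
    one_smul]
  constructor
  · intro h ν
    by_contra hν
    have h1 := (ENNReal.le_tsum ν).trans h
    simp [hν] at h1
  · intro h
    refine le_trans (le_of_eq (ENNReal.tsum_eq_zero.2 fun ν => ?_)) zero_le_one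
    refine le_antisymm (ENNReal.le_of_forall_pos_le_add fun ε hε _ => ?_) zero_le
    refine iInf_le_of_le (ε : ℝ) (iInf_le_of_le (by exact_mod_cast hε)
      (iInf_le_of_le (h ν) ?_))
    simp

/-- A sequence whose terms have the modulus of `φ` at the indices in `A` and vanish elsewhere. -/
def IsCopiesOn (φ : EuclideanSpace ℝ (Fin n) → 𝕜) (A : Finset ℕ)
    (f : ℕ → EuclideanSpace ℝ (Fin n) → 𝕜) : Prop :=
  ∀ ν, ∀ᵐ x, ‖f ν x‖ = ‖if ν ∈ A then φ x else 0‖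

namespace IsCopiesOn

variable {φ : EuclideanSpace ℝ (Fin n) → 𝕜} {A : Finset ℕ}
  {f : ℕ → EuclideanSpace ℝ (Fin n) → 𝕜}

theorem const_smul (h : IsCopiesOn φ A f) (r : ℝ) :
    IsCopiesOn (fun x => r • φ x) A (fun ν x => r • f ν x) := by
  intro ν
  filter_upwards [h ν] with x hx
  rw [norm_smul, hx, ← norm_smul]
  split_ifs <;> simp

theorem mixedModular_top_le_one_iff (p : VariableExponent n) (h : IsCopiesOn φ A f)
    (hA : A.Nonempty) :
    mixedModular p.toFun (fun _ => ∞) f ≤ 1 ↔ varModular p.toFun φ ≤ 1 := by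
  rw [_root_.mixedModular_top_le_one_iff]
  simp only [fun ν => varModular_congr_norm (p := p.toFun) (h ν)]
  constructor
  · obtain ⟨ν, hν⟩ := hA
    intro h1
    simpa [hν] using h1 ν
  · intro h1 ν
    by_cases hν : ν ∈ A
    · simpa [hν] using h1
    · simp [hν, varModular_zero p]

/-- The value does not depend on `A`, so one copy and two copies have equal norm. -/
theorem mixedNorm_top (p : VariableExponent n) (h : IsCopiesOn φ A f) (hA : A.Nonempty) :
    mixedNorm p.toFun (fun _ => ∞) f =
      sInf {r : ℝ | 0 < r ∧ varModular p.toFun (fun x => r⁻¹ • φ x) ≤ 1} := by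
  unfold mixedNorm
  simp only [fun r : ℝ => (h.const_smul r⁻¹).mixedModular_top_le_one_iff p hA]

theorem mixedModular_one (p : VariableExponent n) (h : IsCopiesOn φ A f) :
    mixedModular p.toFun (fun _ => 1) f = A.card * luxemburg p.toFun φ := by
  rw [mixedModular_eq_tsum p.toFun le_rfl ENNReal.one_ne_top]
  simp only [fun ν => luxemburg_congr_norm (p := p.toFun) (h ν), ENNReal.toReal_one,
    ENNReal.rpow_one]
  rw [tsum_eq_sum (s := A) (fun ν hν => by simp [hν, luxemburg_zero p]),
    Finset.sum_congr rfl (g := fun _ => luxemburg p.toFun φ) (fun ν hν => by simp [hν]),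
    Finset.sum_const, nsmul_eq_mul]

theorem memMixed_top (p : VariableExponent n) (h : IsCopiesOn φ A f) (hA : A.Nonempty)
    (hφ : varModular p.toFun φ ≤ 1) : MemMixed p.toFun (fun _ => ∞) f := by
  refine ⟨1, one_pos, ?_⟩
  simp only [inv_one, one_smul]
  exact ((h.mixedModular_top_le_one_iff p hA).2 hφ).trans_lt ENNReal.one_lt_top

theorem memMixed_one (p : VariableExponent n) (h : IsCopiesOn φ A f)
    (hφ : varModular p.toFun φ ≤ 1) : MemMixed p.toFun (fun _ => 1) f := by
  refine ⟨1, one_pos, ?_⟩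
  simp only [inv_one, one_smul]
  rw [h.mixedModular_one p]
  refine ENNReal.mul_lt_top (ENNReal.natCast_lt_top _) ?_
  exact (luxemburg_le one_pos (by simpa using hφ)).trans_lt ENNReal.ofReal_lt_top

theorem mixedNorm_one (p : VariableExponent n) (h : IsCopiesOn φ A f)
    (hφ : varModular p.toFun φ ≤ 1) :
    mixedNorm p.toFun (fun _ => 1) f = A.card * (luxemburg p.toFun φ).toReal := by
  rw [mixedNorm_eq p.toFun le_rfl ENNReal.one_ne_top (h.memMixed_one p hφ),
    h.mixedModular_one p]
  simp

theorem pi_single (F : EuclideanSpace ℝ (Fin n) →ₘ[volume] 𝕜) (i : ℕ) :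
    IsCopiesOn (⇑F) {i}
      (fun ν => ⇑((Pi.single i F : ℕ → (EuclideanSpace ℝ (Fin n) →ₘ[volume] 𝕜)) ν)) := by
  intro ν
  rcases eq_or_ne ν i with rfl | hν
  · simp
  · filter_upwards [AEEqFun.coeFn_zero (α := EuclideanSpace ℝ (Fin n)) (μ := volume) (β := 𝕜)]
      with x hx
    simp [hν, hx]

/-- The supports in the index are disjoint, so a sign changes no modulus, and sum and difference are
treated alike. -/
theorem pi_single_add_or_sub (F : EuclideanSpace ℝ (Fin n) →ₘ[volume] 𝕜)
    {G : ℕ → (EuclideanSpace ℝ (Fin n) →ₘ[volume] 𝕜)}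
    (hG : G = Pi.single 0 F + Pi.single 1 F ∨ G = Pi.single 0 F - Pi.single 1 F) :
    IsCopiesOn (⇑F) {0, 1} (fun ν => ⇑(G ν)) := by
  intro ν
  have h0 := AEEqFun.coeFn_zero (α := EuclideanSpace ℝ (Fin n)) (μ := volume) (β := 𝕜)
  have hneg := AEEqFun.coeFn_neg F
  rcases hG with rfl | rfl
  all_goals
    filter_upwards [h0, hneg] with x hx hx'
    match ν with
    | 0 => simp
    | 1 => simp [hx']
    | k + 2 => simp [hx]

end IsCopiesOn

/-- The bad pair is `u + v`, `u - v`: their sum `2 u` and difference `2 v` have twice the common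
norm. -/
theorem MixedSpace.not_uniformConvexSpace_top (p : VariableExponent n) :
    ¬ UniformConvexSpace (MixedSpace 𝕜 p ∞) := by
  obtain ⟨F, hF, hF1⟩ := exists_ne_zero_varModular_le_one 𝕜 p
  set u : MixedSpace 𝕜 p ∞ := ⟨Pi.single 0 F,
    (IsCopiesOn.pi_single F 0).memMixed_top p (Finset.singleton_nonempty _) hF1⟩
  set v : MixedSpace 𝕜 p ∞ := ⟨Pi.single 1 F,
    (IsCopiesOn.pi_single F 1).memMixed_top p (Finset.singleton_nonempty _) hF1⟩
  have hu0 : u ≠ 0 := fun h => hF (by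
    have h0 := congrArg (fun w : MixedSpace 𝕜 p ∞ => w.1 0) h
    exact (Pi.single_eq_same (M := fun _ : ℕ => _) 0 F).symm.trans h0)
  have nu : ‖u‖ = _ := (IsCopiesOn.pi_single F 0).mixedNorm_top p (Finset.singleton_nonempty _)
  have nv : ‖v‖ = _ := (IsCopiesOn.pi_single F 1).mixedNorm_top p (Finset.singleton_nonempty _)
  have nadd : ‖u + v‖ = _ := (IsCopiesOn.pi_single_add_or_sub F (Or.inl rfl)).mixedNorm_top p
    (Finset.insert_nonempty _ _)
  have nsub : ‖u - v‖ = _ := (IsCopiesOn.pi_single_add_or_sub F (Or.inr rfl)).mixedNorm_top p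
    (Finset.insert_nonempty _ _)
  have h2 : ∀ w : MixedSpace 𝕜 p ∞, ‖w + w‖ = 2 * ‖w‖ := fun w => by
    rw [← two_smul 𝕜, norm_smul, RCLike.norm_ofNat]
  refine not_uniformConvexSpace_of_norm_add_sub (𝕜 := 𝕜) (x := u + v) (y := u - v) ?_
    (nadd.trans nsub.symm) ?_ ?_
  · rw [← norm_ne_zero_iff, nadd, ← nu, norm_ne_zero_iff]
    exact hu0
  · rw [add_add_sub_cancel, h2, nadd, nu]
  · rw [add_sub_sub_cancel, h2, nadd, nv]

/-- The bad pair is `u`, `v` itself, since the norm is proportional to the number of copies. -/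
theorem MixedSpace.not_uniformConvexSpace_one (p : VariableExponent n) :
    ¬ UniformConvexSpace (MixedSpace 𝕜 p 1) := by
  obtain ⟨F, hF, hF1⟩ := exists_ne_zero_varModular_le_one 𝕜 p
  set u : MixedSpace 𝕜 p 1 := ⟨Pi.single 0 F,
    (IsCopiesOn.pi_single F 0).memMixed_one p hF1⟩
  set v : MixedSpace 𝕜 p 1 := ⟨Pi.single 1 F,
    (IsCopiesOn.pi_single F 1).memMixed_one p hF1⟩
  have hu0 : u ≠ 0 := fun h => hF (by
    have h0 := congrArg (fun w : MixedSpace 𝕜 p 1 => w.1 0) h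
    exact (Pi.single_eq_same (M := fun _ : ℕ => _) 0 F).symm.trans h0)
  have nu : ‖u‖ = _ := (IsCopiesOn.pi_single F 0).mixedNorm_one p hF1
  have nv : ‖v‖ = _ := (IsCopiesOn.pi_single F 1).mixedNorm_one p hF1
  have nadd : ‖u + v‖ = _ := (IsCopiesOn.pi_single_add_or_sub F (Or.inl rfl)).mixedNorm_one p hF1
  have nsub : ‖u - v‖ = _ := (IsCopiesOn.pi_single_add_or_sub F (Or.inr rfl)).mixedNorm_one p hF1
  simp only [Finset.card_singleton, Nat.cast_one, one_mul] at nu nv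
  rw [Finset.card_pair zero_ne_one, Nat.cast_ofNat] at nadd nsub
  exact not_uniformConvexSpace_of_norm_add_sub (𝕜 := 𝕜) hu0 (nu.trans nv.symm)
    (by rw [nadd, nu]) (by rw [nsub, nu])

end Counterexamples

theorem mainTheorem4 {𝕜 : Type*} [RCLike 𝕜] {n : ℕ} (p : VariableExponent n) :
    (∀ (q : ℝ≥0∞) [Fact (1 ≤ q)], 1 < q → q < ∞ → 1 < p.lower → p.upper < ∞ →
      UniformConvexSpace (MixedSpace 𝕜 p q)) ∧
    ¬ UniformConvexSpace (MixedSpace 𝕜 p ∞) ∧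
    ¬ UniformConvexSpace (MixedSpace 𝕜 p 1) :=
  ⟨fun _ _ hq1 hq' h1 h2 => MixedSpace.uniformConvexSpace hq1 hq'.ne h1 h2,
    MixedSpace.not_uniformConvexSpace_top p, MixedSpace.not_uniformConvexSpace_one p⟩
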